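/- Let $N\ge 1$, let $\Omega\subset\mathbb{R}^N$ be a bounded open set with Lipschitz boundary (near each boundary point, in suitable orthonormal coordinates, $\Omega$ is the strict epigraph of a Lipschitz function), let $2\le p<\infty$, and let $f\in L^2(\Omega)$. *Admissible controls.* Let $\alpha,\gamma>0$ and let $\xi_1,\xi_2\in L^\infty(\Omega)\cap BV(\Omega)$ satisfy $0<\alpha\le\xi_1(x)\le\xi_2(x)$ for a.e. $x\in\Omega$. Let $\mathfrak{A}_{ad}$ be the set of all symmetric-matrix-valued functions $A\in L^\infty(\Omega;\mathbb{R}^{N\times N}_{\rm sym})$ such that $$\xi_1^2(x)|\eta|^2\le(\eta,A(x)\eta)_{\mathbb{R}^N}\le\xi_2^2(x)|\eta|^2\quad\text{for a.e. }x\in\Omega\text{ and all }\eta\in\mathbb{R}^N,$$ and such that the pointwise positive square root $A^{1/2}$ belongs to $BV(\Omega;\mathbb{R}^{N\times N}_{\rm sym})$ with $\int_\Omega|DA^{1/2}|\le\gamma$. Here, for a symmetric-matrix-valued $S=[s_{ij}]$, $$\int_\Omega|DS|=\sum_{1\le i\le j\le N}\sup\Big\{\int_\Omega s_{ij}\,\mathrm{div}\,\varphi\,dx:\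 \varphi\in C^1_c(\Omega;\mathbb{R}^N),\ |\varphi|\le 1\Big\}.$$ *Truncations.* For each integer $k\ge1$ let $\mathcal{F}_k:[0,\infty)\to[0,\infty)$ be a non-decreasing $C^1$ function with $\mathcal{F}_k(t)=t$ for $0\le t\le k^2$, $\mathcal{F}_k(t)=k^2+1$ for $t>k^2+1$, and, for some $\delta\in(0,1)$, $t\le\mathcal{F}_k(t)\le t+\delta$ for $k^2\le t<k^2+1$. *Regularized solutions.* For $\varepsilon>0$, $k\ge 1$ and $A\in\mathfrak{A}_{ad}$, a function $y\in H^1_0(\Omega)$ is called a solution of the regularized problem with data $(\varepsilon,k,A)$ if it is a weak solution of $$-\mathrm{div}\Big(\big[\varepsilon+\mathcal{F}_k(|A^{1/2}\nabla y|^2)\big]^{\frac{p-2}{2}}A\nabla y\Big)=f\ \text{ in }\Omega,\qquad y=0\ \text{ on }\partial\Omega,$$ that is, if for all $v\in H^1_0(\Omega)$ $$\int_\Omega\big[\varepsilon+\mathcal{F}_k(|A^{1/2}\nabla y|^2)\big]^{\frac{p-2}{2}}(A\nabla y,\nabla v)_{\mathbb{R}^N}\,dx=\int_\Omega f\,v\,dx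 .$$ **Theorem.** Let $\varepsilon$ range over the terms of a strictly decreasing sequence of positive numbers converging to $0$, and let $k$ range over the integers $k\ge 1$. Let $\{A_{\varepsilon,k}\}\subset\mathfrak{A}_{ad}$ be any family of admissible controls, and for each $(\varepsilon,k)$ let $y_{\varepsilon,k}\in H^1_0(\Omega)$ be the corresponding solution of the regularized problem with data $(\varepsilon,k,A_{\varepsilon,k})$. Then every cluster point $y\in H^1_0(\Omega)$ of the family $\{y_{\varepsilon,k}\}$ in the weak topology of $H^1_0(\Omega)$, as $\varepsilon\to0$ and $k\to\infty$, belongs to $W^{1,p}_0(\Omega)$, the closure of $C_c^\infty(\Omega)$ in $W^{1,p}(\Omega)$. In particular, this holds whenever $y_{\varepsilon_i,k_i}\rightharpoonup y$ weakly in $H^1_0(\Omega)$ for some subsequence with $\varepsilon_i\to0$ and $k_i\to\infty$. -/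

import Mathlib

open MeasureTheory Filter Topology Set
open scoped ENNReal ContDiff MatrixOrder

noncomputable section

/-- Euclidean space `ℝ^N`. -/
abbrev Eucl (N : ℕ) : Type := EuclideanSpace ℝ (Fin N)

/-- Near every boundary point, in suitable orthonormal coordinates, `Ω` is the strict epigraph of a
Lipschitz function of the coordinates orthogonal to a unit vector `e`. -/
def HasLipschitzBoundary {N : ℕ} (Ω : Set (Eucl N)) : Prop :=
  ∀ x₀ ∈ frontier Ω, ∃ e : Eucl N, ‖e‖ = 1 ∧
    ∃ (h : ((Submodule.span ℝ {e})ᗮ : Submodule ℝ (Eucl N)) → ℝ) (L : NNReal),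
      LipschitzWith L h ∧ ∃ r : ℝ, 0 < r ∧ ∀ x ∈ Metric.ball x₀ r,
        (x ∈ Ω ↔ h ((Submodule.span ℝ {e})ᗮ.orthogonalProjectionOnto x) < inner ℝ e x)

/-! ### Functions of bounded variation -/

/-- The vector fields `φ ∈ C¹_c(Ω; ℝ^N)` with `|φ| ≤ 1`. -/
structure IsVariationTest {N : ℕ} (Ω : Set (Eucl N)) (φ : Eucl N → Eucl N) : Prop where
  contDiff : ContDiff ℝ 1 φ
  hasCompactSupport : HasCompactSupport φ
  tsupport_subset : tsupport φ ⊆ Ω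
  norm_le_one : ∀ x, ‖φ x‖ ≤ 1

/-- The divergence of a vector field. -/
def divergence {N : ℕ} (φ : Eucl N → Eucl N) (x : Eucl N) : ℝ :=
  ∑ i, fderiv ℝ φ x (EuclideanSpace.single i 1) i

/-- The total variation `∫_Ω |Da| ∈ [0, ∞]` of an integrable function. -/
def totalVariation {N : ℕ} (Ω : Set (Eucl N)) (a : Eucl N → ℝ) : ℝ≥0∞ :=
  ⨆ (φ : Eucl N → Eucl N) (_ : IsVariationTest Ω φ),
    ENNReal.ofReal (∫ x in Ω, a x * divergence φ x)

/-- `a ∈ BV(Ω)`. -/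
def MemBV {N : ℕ} (Ω : Set (Eucl N)) (a : Eucl N → ℝ) : Prop :=
  MemLp a 1 (volume.restrict Ω) ∧ totalVariation Ω a < ⊤

/-- The total variation `∫_Ω |DS|` of a symmetric-matrix-valued function: the sum of the total
variations of the entries `s_{ij}` with `i ≤ j`. -/
def matrixVariation {N : ℕ} (Ω : Set (Eucl N)) (S : Eucl N → Matrix (Fin N) (Fin N) ℝ) : ℝ≥0∞ :=
  ∑ i, ∑ j ∈ Finset.univ.filter (fun j => i ≤ j), totalVariation Ω (fun x => S x i j)

/-- `S ∈ BV(Ω; 𝕊^N)`. -/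
def MemBVMatrix {N : ℕ} (Ω : Set (Eucl N)) (S : Eucl N → Matrix (Fin N) (Fin N) ℝ) : Prop :=
  (∀ᵐ x ∂(volume.restrict Ω), (S x).IsSymm) ∧
  (∀ i j, MemLp (fun x => S x i j) 1 (volume.restrict Ω)) ∧ matrixVariation Ω S < ⊤

/-- The class `𝔄_ad` of admissible controls. The square root `A^{1/2}` is the pointwise positive
semidefinite square root of the matrix `A(x)`. -/
structure IsAdmissibleControl {N : ℕ} (Ω : Set (Eucl N)) (ξ₁ ξ₂ : Eucl N → ℝ) (γ : ℝ)
    (A : Eucl N → Matrix (Fin N) (Fin N) ℝ) : Prop where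
  isSymm : ∀ᵐ x ∂(volume.restrict Ω), (A x).IsSymm
  memLp_top : ∀ i j, MemLp (fun x => A x i j) ⊤ (volume.restrict Ω)
  bounds : ∀ᵐ x ∂(volume.restrict Ω), ∀ η : Eucl N,
    ξ₁ x ^ 2 * ‖η‖ ^ 2 ≤ inner ℝ η ((A x).toEuclideanLin η) ∧
      inner ℝ η ((A x).toEuclideanLin η) ≤ ξ₂ x ^ 2 * ‖η‖ ^ 2
  memBV_sqrt : MemBVMatrix Ω (fun x => CFC.sqrt (A x))
  variation_sqrt_le : matrixVariation Ω (fun x => CFC.sqrt (A x)) ≤ ENNReal.ofReal γ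

/-! ### Sobolev spaces -/

/-- `φ ∈ C_c^∞(Ω)`. -/
structure IsTestFunction {N : ℕ} (Ω : Set (Eucl N)) (φ : Eucl N → ℝ) : Prop where
  contDiff : ContDiff ℝ ∞ φ
  hasCompactSupport : HasCompactSupport φ
  tsupport_subset : tsupport φ ⊆ Ω

/-- `g` is the weak gradient of `y` in `Ω`. -/
def HasWeakGradient {N : ℕ} (Ω : Set (Eucl N)) (y : Eucl N → ℝ) (g : Eucl N → Eucl N) : Prop :=
  ∀ φ, IsTestFunction Ω φ → ∫ x in Ω, y x • gradient φ x = -∫ x in Ω, φ x • g x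

/-- `y ∈ W^{1,p}(Ω)` with weak gradient `g`. -/
structure IsW1pPair {N : ℕ} (Ω : Set (Eucl N)) (p : ℝ≥0∞) (y : Eucl N → ℝ)
    (g : Eucl N → Eucl N) : Prop where
  memLp : MemLp y p (volume.restrict Ω)
  memLp_grad : MemLp g p (volume.restrict Ω)
  weakGradient : HasWeakGradient Ω y g

/-- `y ∈ W₀^{1,p}(Ω)` with weak gradient `g`: the function `y` lies in the closure of `C_c^∞(Ω)` in
`W^{1,p}(Ω)`. -/
structure IsW01pPair {N : ℕ} (Ω : Set (Eucl N)) (p : ℝ≥0∞) (y : Eucl N → ℝ)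
    (g : Eucl N → Eucl N) : Prop extends IsW1pPair Ω p y g where
  approx : ∀ δ : ℝ≥0∞, 0 < δ → ∃ φ, IsTestFunction Ω φ ∧
    eLpNorm (fun x => y x - φ x) p (volume.restrict Ω) < δ ∧
    eLpNorm (fun x => g x - gradient φ x) p (volume.restrict Ω) < δ

/-- `y ∈ W₀^{1,p}(Ω)`. -/
def MemW01p {N : ℕ} (Ω : Set (Eucl N)) (p : ℝ≥0∞) (y : Eucl N → ℝ) : Prop :=
  ∃ g, IsW01pPair Ω p y g

section closure_properties

variable {N : ℕ} {Ω : Set (Eucl N)}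

theorem IsTestFunction.continuous_gradient {φ : Eucl N → ℝ} (h : IsTestFunction Ω φ) :
    Continuous (gradient φ) :=
  (InnerProductSpace.toDual ℝ (Eucl N)).symm.continuous.comp
    (h.contDiff.continuous_fderiv (by simp))

theorem IsTestFunction.hasCompactSupport_gradient {φ : Eucl N → ℝ} (h : IsTestFunction Ω φ) :
    HasCompactSupport (gradient φ) :=
  (h.hasCompactSupport.fderiv ℝ).comp_left (g := (InnerProductSpace.toDual ℝ (Eucl N)).symm)
    (map_zero _)

theorem IsTestFunction.differentiable {φ : Eucl N → ℝ} (h : IsTestFunction Ω φ) :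
    Differentiable ℝ φ :=
  h.contDiff.differentiable (by simp)

theorem IsTestFunction.zero : IsTestFunction Ω (0 : Eucl N → ℝ) where
  contDiff := contDiff_const
  hasCompactSupport := HasCompactSupport.zero
  tsupport_subset := by simp [tsupport]

theorem IsTestFunction.add {φ ψ : Eucl N → ℝ} (h : IsTestFunction Ω φ) (h' : IsTestFunction Ω ψ) :
    IsTestFunction Ω (φ + ψ) where
  contDiff := h.contDiff.add h'.contDiff
  hasCompactSupport := h.hasCompactSupport.add h'.hasCompactSupport
  tsupport_subset := (tsupport_add φ ψ).trans (union_subset h.tsupport_subset h'.tsupport_subset)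

theorem IsTestFunction.const_smul {φ : Eucl N → ℝ} (h : IsTestFunction Ω φ) (c : ℝ) :
    IsTestFunction Ω (c • φ) where
  contDiff := h.contDiff.const_smul c
  hasCompactSupport := h.hasCompactSupport.smul_left (f := fun _ => c)
  tsupport_subset := (tsupport_smul_subset_right (fun _ => c) φ).trans h.tsupport_subset

theorem IsW1pPair.integrable_smul_gradient {p : ℝ≥0∞} (hp : 1 ≤ p) {y : Eucl N → ℝ}
    {g : Eucl N → Eucl N} (h : IsW1pPair Ω p y g) {φ : Eucl N → ℝ} (hφ : IsTestFunction Ω φ) :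
    Integrable (fun x => y x • gradient φ x) (volume.restrict Ω) :=
  (h.memLp.locallyIntegrable hp).integrable_smul_right_of_hasCompactSupport
    hφ.continuous_gradient hφ.hasCompactSupport_gradient

theorem IsW1pPair.integrable_smul {p : ℝ≥0∞} (hp : 1 ≤ p) {y : Eucl N → ℝ}
    {g : Eucl N → Eucl N} (h : IsW1pPair Ω p y g) {φ : Eucl N → ℝ} (hφ : IsTestFunction Ω φ) :
    Integrable (fun x => φ x • g x) (volume.restrict Ω) :=
  (h.memLp_grad.locallyIntegrable hp).integrable_smul_left_of_hasCompactSupport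
    hφ.contDiff.continuous hφ.hasCompactSupport

theorem gradient_zero_fun : gradient (0 : Eucl N → ℝ) = 0 := by
  ext1 x
  exact gradient_const x 0

theorem gradient_add_fun {φ ψ : Eucl N → ℝ} (h : Differentiable ℝ φ) (h' : Differentiable ℝ ψ)
    (x : Eucl N) : gradient (φ + ψ) x = gradient φ x + gradient ψ x := by
  simp only [gradient]
  rw [fderiv_add (h x) (h' x), map_add]

theorem gradient_smul_fun {φ : Eucl N → ℝ} (h : Differentiable ℝ φ) (c : ℝ)
    (x : Eucl N) : gradient (c • φ) x = c • gradient φ x := by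
  simp only [gradient]
  rw [fderiv_const_smul (h x), map_smulₛₗ]
  simp

theorem IsW01pPair.congr {p : ℝ≥0∞} {y y' : Eucl N → ℝ} {g g' : Eucl N → Eucl N}
    (hy : y =ᵐ[volume.restrict Ω] y') (hg : g =ᵐ[volume.restrict Ω] g')
    (h : IsW01pPair Ω p y g) : IsW01pPair Ω p y' g' where
  memLp := (memLp_congr_ae hy).1 h.memLp
  memLp_grad := (memLp_congr_ae hg).1 h.memLp_grad
  weakGradient φ hφ := by
    rw [← integral_congr_ae (hy.mono fun x hx => by simp only [hx] :
        (fun x => y x • gradient φ x) =ᵐ[volume.restrict Ω] fun x => y' x • gradient φ x),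
      ← integral_congr_ae (hg.mono fun x hx => by simp only [hx] :
        (fun x => φ x • g x) =ᵐ[volume.restrict Ω] fun x => φ x • g' x)]
    exact h.weakGradient φ hφ
  approx δ hδ := by
    obtain ⟨φ, hφ, h1, h2⟩ := h.approx δ hδ
    refine ⟨φ, hφ, ?_, ?_⟩
    · rwa [← eLpNorm_congr_ae (hy.mono fun x hx => by simp only [hx] :
        (fun x => y x - φ x) =ᵐ[volume.restrict Ω] fun x => y' x - φ x)]
    · rwa [← eLpNorm_congr_ae (hg.mono fun x hx => by simp only [hx] :
        (fun x => g x - gradient φ x) =ᵐ[volume.restrict Ω] fun x => g' x - gradient φ x)]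

theorem IsW01pPair.zero {p : ℝ≥0∞} : IsW01pPair Ω p (0 : Eucl N → ℝ) 0 where
  memLp := MemLp.zero
  memLp_grad := MemLp.zero
  weakGradient φ _ := by simp
  approx δ hδ := ⟨0, IsTestFunction.zero, by simpa using hδ, by
    simpa [gradient_zero_fun] using hδ⟩

theorem IsW01pPair.add {p : ℝ≥0∞} (hp : 1 ≤ p) {y y' : Eucl N → ℝ} {g g' : Eucl N → Eucl N}
    (h : IsW01pPair Ω p y g) (h' : IsW01pPair Ω p y' g') : IsW01pPair Ω p (y + y') (g + g') where
  memLp := h.memLp.add h'.memLp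
  memLp_grad := h.memLp_grad.add h'.memLp_grad
  weakGradient φ hφ := by
    simp only [Pi.add_apply, add_smul, smul_add]
    rw [integral_add (h.integrable_smul_gradient hp hφ) (h'.integrable_smul_gradient hp hφ),
      integral_add (h.integrable_smul hp hφ) (h'.integrable_smul hp hφ),
      h.weakGradient φ hφ, h'.weakGradient φ hφ, neg_add]
  approx δ hδ := by
    have hδ2 : 0 < δ / 2 := ENNReal.half_pos hδ.ne'
    obtain ⟨φ, hφ, h1, h2⟩ := h.approx _ hδ2
    obtain ⟨ψ, hψ, h3, h4⟩ := h'.approx _ hδ2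
    refine ⟨φ + ψ, hφ.add hψ, ?_, ?_⟩
    · have e : (fun x => (y + y') x - (φ + ψ) x) =
          (fun x => y x - φ x) + fun x => y' x - ψ x := by
        ext x; simp only [Pi.add_apply]; ring
      rw [e]
      calc _ ≤ _ := eLpNorm_add_le
              (h.memLp.1.sub hφ.contDiff.continuous.aestronglyMeasurable)
              (h'.memLp.1.sub hψ.contDiff.continuous.aestronglyMeasurable) hp
        _ < δ / 2 + δ / 2 := ENNReal.add_lt_add h1 h3
        _ = δ := ENNReal.add_halves δ
    · have e : (fun x => (g + g') x - gradient (φ + ψ) x) =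
          (fun x => g x - gradient φ x) + fun x => g' x - gradient ψ x := by
        ext1 x
        simp only [Pi.add_apply, gradient_add_fun hφ.differentiable hψ.differentiable]
        abel
      rw [e]
      calc _ ≤ _ := eLpNorm_add_le
              (h.memLp_grad.1.sub hφ.continuous_gradient.aestronglyMeasurable)
              (h'.memLp_grad.1.sub hψ.continuous_gradient.aestronglyMeasurable) hp
        _ < δ / 2 + δ / 2 := ENNReal.add_lt_add h2 h4
        _ = δ := ENNReal.add_halves δ

theorem IsW01pPair.const_smul {p : ℝ≥0∞} {y : Eucl N → ℝ} {g : Eucl N → Eucl N}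
    (h : IsW01pPair Ω p y g) (c : ℝ) : IsW01pPair Ω p (c • y) (c • g) where
  memLp := h.memLp.const_smul c
  memLp_grad := h.memLp_grad.const_smul c
  weakGradient φ hφ := by
    have h1 : ∀ x, (c • y) x • gradient φ x = c • (y x • gradient φ x) := fun x => by
      simp [smul_smul]
    have h2 : ∀ x, φ x • (c • g) x = c • (φ x • g x) := fun x => by
      simp [smul_smul, mul_comm]
    simp only [h1, h2, integral_smul]
    rw [h.weakGradient φ hφ, smul_neg]
  approx δ hδ := by
    rcases eq_or_ne c 0 with rfl | hc
    · exact ⟨0, IsTestFunction.zero, by simpa using hδ, by simpa [gradient_zero_fun] using hδ⟩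
    have hc0 : ‖c‖ₑ ≠ 0 := by simpa using hc
    have hct : ‖c‖ₑ ≠ ⊤ := enorm_ne_top
    obtain ⟨φ, hφ, h1, h2⟩ := h.approx (δ / ‖c‖ₑ) (ENNReal.div_pos hδ.ne' hct)
    refine ⟨c • φ, hφ.const_smul c, ?_, ?_⟩
    · have e : (fun x => (c • y) x - (c • φ) x) = c • fun x => y x - φ x := by
        ext x; simp [mul_sub]
      rw [e, eLpNorm_const_smul, mul_comm]
      exact (ENNReal.lt_div_iff_mul_lt (Or.inl hc0) (Or.inl hct)).1 h1
    · have e : (fun x => (c • g) x - gradient (c • φ) x) = c • fun x => g x - gradient φ x := by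
        ext1 x
        simp only [Pi.smul_apply, gradient_smul_fun hφ.differentiable, smul_sub]
      rw [e, eLpNorm_const_smul, mul_comm]
      exact (ENNReal.lt_div_iff_mul_lt (Or.inl hc0) (Or.inl hct)).1 h2

end closure_properties

/-- The space `H₀¹(Ω) = W₀^{1,2}(Ω)`, realised as the space of pairs `(y, ∇y)` in
`L²(Ω) × L²(Ω)^N`; the norm inherited from the product is equivalent to the usual one. -/
def H01 {N : ℕ} (Ω : Set (Eucl N)) :
    Submodule ℝ (Lp ℝ 2 (volume.restrict Ω) × Lp (Eucl N) 2 (volume.restrict Ω)) where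
  carrier := {w | IsW01pPair Ω 2 w.1 w.2}
  zero_mem' := IsW01pPair.zero.congr (Lp.coeFn_zero _ _ _).symm (Lp.coeFn_zero _ _ _).symm
  add_mem' {a b} ha hb := (IsW01pPair.add (by norm_num) ha hb).congr
    (Lp.coeFn_add a.1 b.1).symm (Lp.coeFn_add a.2 b.2).symm
  smul_mem' c a ha := (IsW01pPair.const_smul ha c).congr
    (Lp.coeFn_smul c a.1).symm (Lp.coeFn_smul c a.2).symm

/-- The function underlying an element of `H₀¹(Ω)`. -/
def H01.fn {N : ℕ} {Ω : Set (Eucl N)} (y : H01 Ω) : Eucl N → ℝ := y.1.1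

/-- The weak gradient of an element of `H₀¹(Ω)`. -/
def H01.grad {N : ℕ} {Ω : Set (Eucl N)} (y : H01 Ω) : Eucl N → Eucl N := y.1.2

/-! ### The regularized boundary value problem -/

/-- The truncation functions `𝓕_k : ℝ₊ → ℝ₊`; values at negative arguments are irrelevant. -/
structure IsTruncation (k : ℕ) (F : ℝ → ℝ) : Prop where
  mapsTo : MapsTo F (Ici 0) (Ici 0)
  monotoneOn : MonotoneOn F (Ici 0)
  contDiffOn : ContDiffOn ℝ 1 F (Ici 0)
  eq_self : ∀ t ∈ Icc (0 : ℝ) ((k : ℝ) ^ 2), F t = t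
  eq_const : ∀ t : ℝ, (k : ℝ) ^ 2 + 1 < t → F t = (k : ℝ) ^ 2 + 1
  between : ∃ δ ∈ Ioo (0 : ℝ) 1, ∀ t ∈ Ico ((k : ℝ) ^ 2) ((k : ℝ) ^ 2 + 1), t ≤ F t ∧ F t ≤ t + δ

/-- `y ∈ H₀¹(Ω)` is the weak solution of
`-div([ε + F(|A^{1/2}∇y|²)]^{(p-2)/2} A∇y) = f` in `Ω`. -/
def IsRegularizedSolution {N : ℕ} (Ω : Set (Eucl N)) (p : ℝ) (f : Eucl N → ℝ) (ε : ℝ)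
    (F : ℝ → ℝ) (A : Eucl N → Matrix (Fin N) (Fin N) ℝ) (y : H01 Ω) : Prop :=
  ∀ v : H01 Ω,
    ∫ x in Ω, (ε + F (‖(CFC.sqrt (A x)).toEuclideanLin (H01.grad y x)‖ ^ 2)) ^ ((p - 2) / 2) *
        inner ℝ ((A x).toEuclideanLin (H01.grad y x)) (H01.grad v x)
      = ∫ x in Ω, f x * H01.fn v x

end

/-!
Testing the equation with its own solution and using Poincaré's inequality bounds the Dirichlet
energy `t = |A^{1/2}∇y|²` in `L¹`, and `min(t, k²)^{p/2}` in `L¹` as well, uniformly in `ε`, `k` and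
the control (`IsRegularizedSolution.exists_energy_bound`). So `∇y` is bounded in `L^p` on the set
`{t ≤ k²}`, while on its complement `|∇y| ≤ α⁻¹ √t ≤ α⁻¹ t / k` tends to zero in `L¹`. Tested
against bounded fields, a weak cluster point therefore sees only the first part, and duality puts
its gradient into `L^p` (`setLIntegral_enorm_rpow_le_of_mapClusterPt`).

It remains to see that an element of `H₀¹(Ω)` with gradient in `L^p` lies in `W₀^{1,p}(Ω)`, the
closure of the test functions. Integrating along segments that leave `Ω` gives
`|y(x)| ≤ ∫₀^{2R} |∇y(x + te)| dt` almost everywhere, hence `y ∈ L^p`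
(`IsW01pPair.eLpNorm_le_eLpNorm_grad`). The extension of `y` by zero is weakly differentiable on the
whole space. Near each point of the closure of `Ω` a translation in a suitable direction moves the
closure into `Ω` with a margin proportional to the displacement, because the boundary is Lipschitz
(`HasLipschitzBoundary.exists_cone`). A cut-off of `y`, mollified with a kernel centred at the
translation vector, is thus a test function of `Ω` close to the cut-off in `W^{1,p}`, and finitely
many cut-offs add up to `y` (`IsW01pPair.isW01pPair_of_memLp`).
-/

/-! ### Integral inequalities and translations in `L^p` -/

/-- Jensen's inequality for the power `q > 1` and a measure of arbitrary total mass. -/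
theorem lintegral_rpow_le_of_one_lt {T : Type*} [MeasurableSpace T] {ν : Measure T} {q : ℝ}
    (hq : 1 < q) {f : T → ℝ≥0∞} (hf : AEMeasurable f ν) :
    (∫⁻ z, f z ∂ν) ^ q ≤ ν univ ^ (q - 1) * ∫⁻ z, f z ^ q ∂ν := by
  have hc := Real.HolderConjugate.conjExponent hq
  have h := ENNReal.lintegral_mul_le_Lp_mul_Lq ν hc hf (aemeasurable_const (b := (1 : ℝ≥0∞)))
  simp only [Pi.mul_apply, mul_one, ENNReal.one_rpow, lintegral_const, one_mul] at h
  have h2 := ENNReal.rpow_le_rpow h (by linarith : 0 ≤ q)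
  rw [ENNReal.mul_rpow_of_nonneg _ _ (by linarith), ← ENNReal.rpow_mul, ← ENNReal.rpow_mul] at h2
  have e1 : 1 / q * q = 1 := by field_simp
  have e2 : 1 / q.conjExponent * q = q - 1 := by
    rw [Real.conjExponent]; have : q - 1 ≠ 0 := by linarith
    field_simp
  rw [e1, e2, ENNReal.rpow_one] at h2
  rwa [mul_comm]

/-- A form of Minkowski's integral inequality: if all slices `K · z` have `L^p` norm at most `D`,
then `∫ K · z dν(z)` has `L^p` norm at most `ν(T) D`. -/
theorem eLpNorm_lintegral_le {X T : Type*} [MeasurableSpace X] [MeasurableSpace T]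
    {μ : Measure X} [SFinite μ] {ν : Measure T} [IsFiniteMeasure ν] {p : ℝ≥0∞} (hp : 1 < p)
    (hp' : p ≠ ⊤) {K : X → T → ℝ≥0∞} (hK : Measurable (Function.uncurry K)) {D : ℝ≥0∞}
    (hD : ∀ᵐ z ∂ν, eLpNorm (fun x => K x z) p μ ≤ D) :
    eLpNorm (fun x => ∫⁻ z, K x z ∂ν) p μ ≤ ν univ * D := by
  have hp0 : p ≠ 0 := (zero_lt_one.trans hp).ne'
  set q := p.toReal with hqdef
  have hq : 1 < q := by
    have := (ENNReal.toReal_lt_toReal ENNReal.one_ne_top hp').2 hp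
    simpa using this
  have hq0 : 0 < q := by linarith
  have key : ∫⁻ x, (∫⁻ z, K x z ∂ν) ^ q ∂μ ≤ (ν univ * D) ^ q := by
    have hm : Measurable fun w : X × T => K w.1 w.2 ^ q := hK.pow_const q
    calc ∫⁻ x, (∫⁻ z, K x z ∂ν) ^ q ∂μ
        ≤ ∫⁻ x, ν univ ^ (q - 1) * ∫⁻ z, K x z ^ q ∂ν ∂μ :=
          lintegral_mono fun x =>
            lintegral_rpow_le_of_one_lt hq (hK.comp measurable_prodMk_left).aemeasurable
      _ = ν univ ^ (q - 1) * ∫⁻ z, ∫⁻ x, K x z ^ q ∂μ ∂ν := by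
          rw [lintegral_const_mul _ hm.lintegral_prod_right,
            lintegral_lintegral_swap hm.aemeasurable]
      _ ≤ ν univ ^ (q - 1) * ∫⁻ z, D ^ q ∂ν := by
          refine mul_le_mul' le_rfl ?_
          refine lintegral_mono_ae (hD.mono fun z hz => ?_)
          have := ENNReal.rpow_le_rpow hz hq0.le
          rw [eLpNorm_eq_lintegral_rpow_enorm_toReal hp0 hp', ← ENNReal.rpow_mul, ← hqdef,
            one_div, inv_mul_cancel₀ hq0.ne', ENNReal.rpow_one] at this
          simpa using this
      _ = (ν univ * D) ^ q := by
          rw [lintegral_const, ENNReal.mul_rpow_of_nonneg _ _ hq0.le]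
          have : ν univ ^ q = ν univ ^ (q - 1) * ν univ := by
            conv_lhs => rw [← sub_add_cancel q 1]
            rw [ENNReal.rpow_add_of_nonneg _ _ (by linarith) zero_le_one, ENNReal.rpow_one]
          rw [this]; ring
  rw [eLpNorm_eq_lintegral_rpow_enorm_toReal hp0 hp', ← hqdef]
  simp only [enorm_eq_self]
  calc _ ≤ ((ν univ * D) ^ q) ^ (1 / q) := by gcongr
    _ = _ := by rw [← ENNReal.rpow_mul, mul_one_div_cancel hq0.ne', ENNReal.rpow_one]

/-- Translations act continuously on `L^p`, `1 ≤ p < ∞`. -/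
theorem tendsto_eLpNorm_translate_sub {E F : Type*} [NormedAddCommGroup E] [NormedSpace ℝ E]
    [FiniteDimensional ℝ E] [MeasurableSpace E] [BorelSpace E] [NormedAddCommGroup F]
    {μ : Measure E} [μ.IsAddHaarMeasure] {p : ℝ≥0∞} (hp : 1 ≤ p) (hp' : p ≠ ⊤) {w : E → F}
    (hw : MemLp w p μ) :
    Tendsto (fun z : E => eLpNorm (fun x => w (z + x) - w x) p μ) (𝓝 0) (𝓝 0) := by
  have : Fact (1 ≤ p) := ⟨hp⟩
  have : Fact (p ≠ ⊤) := ⟨hp'⟩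
  have hc : Continuous fun z : E => (DomAddAct.mk z) +ᵥ hw.toLp w :=
    (continuous_id.vadd continuous_const).comp DomAddAct.continuous_mk
  have h0 : Tendsto (fun z : E => edist ((DomAddAct.mk z) +ᵥ hw.toLp w) (hw.toLp w))
      (𝓝 0) (𝓝 0) := by
    have := (hc.edist (continuous_const (y := hw.toLp w))).tendsto 0
    simpa using this
  refine h0.congr fun z => ?_
  rw [DomAddAct.mk_vadd_toLp, Lp.edist_toLp_toLp]
  rfl

/-! ### Mollification and the Poincaré inequality -/

/-- Averages of `w ∈ L^p` against probability densities supported near the origin are `L^p`-close to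
`w`. The density need not be even or centred at the origin, which is what allows mollifying while
moving the support into `Ω`. -/
theorem exists_eLpNorm_mollify_sub_le {N : ℕ} {F : Type*} [NormedAddCommGroup F]
    [NormedSpace ℝ F] [CompleteSpace F] {p : ℝ≥0∞} (hp : 1 < p) (hp' : p ≠ ⊤) {w : Eucl N → F}
    (hwm : StronglyMeasurable w) (hw : MemLp w p volume) {δ : ℝ≥0∞} (hδ : 0 < δ) :
    ∃ r : ℝ, 0 < r ∧ ∀ η : Eucl N → ℝ, Continuous η → (∀ z, 0 ≤ η z) → ∫ z, η z = 1 →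
      (∀ z, η z ≠ 0 → ‖z‖ < r) →
      eLpNorm (fun x => w x - ∫ z, η z • w (x - z)) p volume ≤ δ := by
  have ht := (tendsto_eLpNorm_translate_sub hp.le hp' hw).eventually (ge_mem_nhds hδ)
  obtain ⟨r, hr, hball⟩ := Metric.eventually_nhds_iff.1 ht
  refine ⟨r, hr, fun η hηc hη0 hη1 hηr => ?_⟩
  have hηs : HasCompactSupport η := by
    refine HasCompactSupport.of_support_subset_isCompact (isCompact_closedBall (0 : Eucl N) r) ?_
    intro z hz
    simpa using (hηr z hz).le
  have hηi : Integrable η volume := hηc.integrable_of_hasCompactSupport hηs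
  set ν : Measure (Eucl N) := volume.withDensity fun z => ENNReal.ofReal (η z) with hν
  have hηm : Measurable fun z => ENNReal.ofReal (η z) := hηc.measurable.ennreal_ofReal
  have hν1 : ν univ = 1 := by
    rw [hν, withDensity_apply _ MeasurableSet.univ, Measure.restrict_univ,
      ← ofReal_integral_eq_lintegral_ofReal hηi (Eventually.of_forall hη0), hη1, ENNReal.ofReal_one]
  have : IsFiniteMeasure ν := ⟨by rw [hν1]; exact ENNReal.one_lt_top⟩
  have hint : ∀ x, Integrable (fun z => η z • w (x - z)) volume := fun x => by
    have h1 : LocallyIntegrable (fun z => w (x - z)) volume := by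
      have := (Measure.measurePreserving_sub_left (volume : Measure (Eucl N)) x)
      exact (hw.comp_measurePreserving this).locallyIntegrable hp.le
    exact h1.integrable_smul_left_of_hasCompactSupport hηc hηs
  have hK : Measurable (Function.uncurry fun x z : Eucl N => ‖w x - w (x - z)‖ₑ) := by
    have h1 : StronglyMeasurable fun q : Eucl N × Eucl N => w q.1 :=
      hwm.comp_measurable measurable_fst
    have h2 : StronglyMeasurable fun q : Eucl N × Eucl N => w (q.1 - q.2) :=
      hwm.comp_measurable (measurable_fst.sub measurable_snd)
    exact (h1.sub h2).enorm
  calc eLpNorm (fun x => w x - ∫ z, η z • w (x - z)) p volume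
      ≤ eLpNorm (fun x => ∫⁻ z, ‖w x - w (x - z)‖ₑ ∂ν) p volume := by
        refine eLpNorm_mono_enorm fun x => ?_
        have e : w x - ∫ z, η z • w (x - z) = ∫ z, η z • (w x - w (x - z)) := by
          simp only [smul_sub]
          rw [integral_sub (hηi.smul_const _) (hint x), integral_smul_const, hη1, one_smul]
        have hKx : Measurable fun z => ‖w x - w (x - z)‖ₑ := hK.comp measurable_prodMk_left
        rw [e, enorm_eq_self, hν, lintegral_withDensity_eq_lintegral_mul _ hηm hKx]
        refine (enorm_integral_le_lintegral_enorm _).trans (lintegral_mono fun z => ?_)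
        simp only [Pi.mul_apply, enorm_smul]
        rw [Real.enorm_of_nonneg (hη0 z)]
    _ ≤ ν univ * δ := by
        refine eLpNorm_lintegral_le hp hp' hK ?_
        rw [hν, ae_withDensity_iff hηm]
        refine Eventually.of_forall fun z hz => ?_
        have hz' : η z ≠ 0 := fun h => hz (by simp [h])
        have h3 := @hball (-z) (by simpa using hηr z hz')
        have e : (fun x => ‖w x - w (x - z)‖ₑ) = fun x => ‖w (-z + x) - w x‖ₑ := by
          ext x
          rw [← enorm_neg, neg_sub, sub_eq_neg_add x z]
        rw [e, eLpNorm_enorm]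
        exact h3
    _ = δ := by rw [hν1, one_mul]

section Sobolev

variable {N : ℕ} {Ω : Set (Eucl N)}

theorem IsTestFunction.gradient_eq_zero {φ : Eucl N → ℝ} (h : IsTestFunction Ω φ) {x : Eucl N}
    (hx : x ∉ Ω) : gradient φ x = 0 := by
  have h1 : fderiv ℝ φ x = 0 :=
    image_eq_zero_of_notMem_tsupport fun hx' =>
      hx (h.tsupport_subset (tsupport_fderiv_subset ℝ hx'))
  simp [gradient, h1]

/-- Fundamental theorem of calculus along a segment of length `2R`, whose far end lies outside `Ω`
whenever `x ∈ Ω`. -/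
theorem IsTestFunction.enorm_le_lintegral_gradient {φ : Eucl N → ℝ} (h : IsTestFunction Ω φ)
    {R : ℝ} (hΩ : Ω ⊆ Metric.ball 0 R) {e : Eucl N} (he : ‖e‖ = 1) (x : Eucl N) :
    ‖φ x‖ₑ ≤ ∫⁻ t in Ioc 0 (2 * R), ‖gradient φ (x + t • e)‖ₑ := by
  by_cases hx : x ∈ Ω
  swap
  · rw [image_eq_zero_of_notMem_tsupport fun hx' => hx (h.tsupport_subset hx')]
    simp
  have hxR : ‖x‖ < R := by simpa using hΩ hx
  have hR : 0 ≤ 2 * R := by have := norm_nonneg x; linarith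
  have hout : φ (x + (2 * R) • e) = 0 := by
    refine image_eq_zero_of_notMem_tsupport fun hx' => ?_
    have h1 : ‖x + (2 * R) • e‖ < R := by simpa using hΩ (h.tsupport_subset hx')
    have h2 : ‖(2 * R) • e‖ ≤ ‖x + (2 * R) • e‖ + ‖x‖ := by
      simpa using norm_sub_le (x + (2 * R) • e) x
    rw [norm_smul, he, mul_one, Real.norm_of_nonneg hR] at h2
    linarith
  have hd : ∀ t : ℝ, HasDerivAt (fun t : ℝ => φ (x + t • e))
      (inner ℝ (gradient φ (x + t • e)) e) t := fun t => by
    have h1 : HasDerivAt (fun t : ℝ => x + t • e) e t := by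
      simpa using ((hasDerivAt_id t).smul_const e).const_add x
    have h2 := (h.differentiable (x + t • e)).hasFDerivAt.comp_hasDerivAt t h1
    have h3 : inner ℝ (gradient φ (x + t • e)) e = fderiv ℝ φ (x + t • e) e := by simp [gradient]
    rw [h3]
    exact h2
  have hline : Continuous fun t : ℝ => x + t • e := by fun_prop
  have hcont : Continuous fun t : ℝ => (inner ℝ (gradient φ (x + t • e)) e : ℝ) :=
    (h.continuous_gradient.comp hline).inner continuous_const
  have hftc := intervalIntegral.integral_eq_sub_of_hasDerivAt (fun t _ => hd t)
    (hcont.intervalIntegrable 0 (2 * R))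
  simp only [hout, zero_smul, add_zero, zero_sub] at hftc
  rw [← enorm_neg, ← hftc, intervalIntegral.integral_of_le hR]
  refine (enorm_integral_le_lintegral_enorm _).trans (lintegral_mono fun t => ?_)
  rw [← ofReal_norm, ← ofReal_norm]
  refine ENNReal.ofReal_le_ofReal ((norm_inner_le_norm _ _).trans ?_)
  rw [he, mul_one]

theorem measurable_lintegral_line {H : Eucl N → ℝ≥0∞} (hH : Measurable H) (L : ℝ) (e : Eucl N) :
    Measurable fun x : Eucl N => ∫⁻ t in Ioc 0 L, H (x + t • e) := by
  have h : Measurable fun q : Eucl N × ℝ => H (q.1 + q.2 • e) := hH.comp (by fun_prop)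
  exact h.lintegral_prod_right'

theorem eLpNorm_lintegral_line_le {p : ℝ≥0∞} (hp : 1 < p) (hp' : p ≠ ⊤) {H : Eucl N → ℝ≥0∞}
    (hH : Measurable H) (L : ℝ) (e : Eucl N) :
    eLpNorm (fun x : Eucl N => ∫⁻ t in Ioc 0 L, H (x + t • e)) p volume
      ≤ ENNReal.ofReal L * eLpNorm H p volume := by
  have h := eLpNorm_lintegral_le (μ := (volume : Measure (Eucl N)))
    (ν := (volume : Measure ℝ).restrict (Ioc 0 L)) hp hp'
    (K := fun x t => H (x + t • e)) (D := eLpNorm H p volume) (hH.comp (by fun_prop)) ?_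
  · simpa using h
  · refine Eventually.of_forall fun t => le_of_eq ?_
    exact eLpNorm_comp_measurePreserving hH.aestronglyMeasurable
      (measurePreserving_add_right (volume : Measure (Eucl N)) (t • e))

theorem eLpNorm_enorm_indicator_eq_restrict {F : Type*} [NormedAddCommGroup F]
    (hΩ : MeasurableSet Ω) {p : ℝ≥0∞} (g : Eucl N → F) :
    eLpNorm (fun x => ‖Ω.indicator g x‖ₑ) p volume = eLpNorm g p (volume.restrict Ω) := by
  rw [eLpNorm_enorm, eLpNorm_indicator_eq_eLpNorm_restrict hΩ]

/-- The pointwise bound `|y(x)| ≤ ∫₀^{2R} |g(x + te)| dt` passes from test functions to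
`W₀^{1,p}(Ω)`, with `g` extended by zero. The exponent `p` does not occur in the bound, so it
yields a Poincaré inequality in every `L^q`. -/
theorem IsW01pPair.enorm_le_lintegral {p : ℝ≥0∞} (hp : 1 < p) (hp' : p ≠ ⊤)
    {y : Eucl N → ℝ} {g : Eucl N → Eucl N} (h : IsW01pPair Ω p y g) (hg : StronglyMeasurable g)
    (hy : StronglyMeasurable y)
    (hΩm : MeasurableSet Ω) {R : ℝ} (hΩ : Ω ⊆ Metric.ball 0 R) {e : Eucl N} (he : ‖e‖ = 1) :
    ∀ᵐ x ∂(volume.restrict Ω),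
      ‖y x‖ₑ ≤ ∫⁻ t in Ioc 0 (2 * R), ‖Ω.indicator g (x + t • e)‖ₑ := by
  have hgi : StronglyMeasurable (Ω.indicator g) := hg.indicator hΩm
  set S : Eucl N → ℝ≥0∞ := fun x => ∫⁻ t in Ioc 0 (2 * R), ‖Ω.indicator g (x + t • e)‖ₑ with hS
  have hSm : Measurable S := measurable_lintegral_line hgi.enorm _ e
  -- truncated subtraction: the excess of `|y|` over `S` is controlled by the approximation error
  have hle : ∀ δ : ℝ≥0∞, 0 < δ → eLpNorm (fun x => ‖y x‖ₑ - S x) p (volume.restrict Ω)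
      ≤ δ + ENNReal.ofReal (2 * R) * δ := fun δ hδ => by
    obtain ⟨φ, hφ, h1, h2⟩ := h.approx δ hδ
    have hφm : StronglyMeasurable (gradient φ) := hφ.continuous_gradient.stronglyMeasurable
    set H : Eucl N → ℝ≥0∞ := fun x => ‖Ω.indicator (fun x => g x - gradient φ x) x‖ₑ with hH
    have hHm : Measurable H := ((hg.sub hφm).indicator hΩm).enorm
    have hpt : ∀ x, ‖y x‖ₑ - S x ≤ ‖y x - φ x‖ₑ
        + ∫⁻ t in Ioc 0 (2 * R), H (x + t • e) := fun x => by
      rw [tsub_le_iff_right, add_assoc]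
      calc ‖y x‖ₑ = ‖(y x - φ x) + φ x‖ₑ := by rw [sub_add_cancel]
        _ ≤ ‖y x - φ x‖ₑ + ‖φ x‖ₑ := enorm_add_le _ _
        _ ≤ ‖y x - φ x‖ₑ + ∫⁻ t in Ioc 0 (2 * R),
              (H (x + t • e) + ‖Ω.indicator g (x + t • e)‖ₑ) := by
            gcongr
            refine (hφ.enorm_le_lintegral_gradient hΩ he x).trans (lintegral_mono fun t => ?_)
            simp only [hH]
            by_cases hz : x + t • e ∈ Ω
            · rw [indicator_of_mem hz, indicator_of_mem hz, ← enorm_neg (g _ - _), neg_sub]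
              simpa using enorm_add_le (gradient φ (x + t • e) - g (x + t • e)) (g (x + t • e))
            · simp [hφ.gradient_eq_zero hz]
        _ = _ := by
            rw [lintegral_add_left]
            exact hHm.comp (by fun_prop)
    calc eLpNorm (fun x => ‖y x‖ₑ - S x) p (volume.restrict Ω)
        ≤ eLpNorm ((fun x => ‖y x - φ x‖ₑ) + fun x => ∫⁻ t in Ioc 0 (2 * R), H (x + t • e))
            p (volume.restrict Ω) := eLpNorm_mono_enorm fun x => by simpa using hpt x
      _ ≤ eLpNorm (fun x => ‖y x - φ x‖ₑ) p (volume.restrict Ω)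
            + eLpNorm (fun x => ∫⁻ t in Ioc 0 (2 * R), H (x + t • e)) p (volume.restrict Ω) :=
          eLpNorm_add_le
            (hy.sub hφ.contDiff.continuous.stronglyMeasurable).enorm.aestronglyMeasurable
            (measurable_lintegral_line hHm _ e).aestronglyMeasurable hp.le
      _ ≤ δ + ENNReal.ofReal (2 * R) * δ := by
          refine add_le_add ((eLpNorm_enorm _).trans_le h1.le) ?_
          refine (eLpNorm_mono_measure _ Measure.restrict_le_self).trans
            ((eLpNorm_lintegral_line_le hp hp' hHm _ e).trans ?_)
          rw [hH, eLpNorm_enorm_indicator_eq_restrict hΩm]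
          gcongr
  have hzero : eLpNorm (fun x => ‖y x‖ₑ - S x) p (volume.restrict Ω) = 0 := by
    have ht : Tendsto (fun δ : ℝ≥0∞ => δ + ENNReal.ofReal (2 * R) * δ) (𝓝[>] 0) (𝓝 0) := by
      have : Continuous fun δ : ℝ≥0∞ => δ + ENNReal.ofReal (2 * R) * δ :=
        continuous_id.add (ENNReal.continuous_const_mul ENNReal.ofReal_ne_top)
      simpa using (this.tendsto 0).mono_left nhdsWithin_le_nhds
    exact le_antisymm (ge_of_tendsto ht (eventually_mem_nhdsWithin.mono hle)) bot_le
  have hm : Measurable fun x => ‖y x‖ₑ - S x := hy.enorm.sub hSm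
  rw [eLpNorm_eq_zero_iff hm.aestronglyMeasurable (zero_lt_one.trans hp).ne'] at hzero
  filter_upwards [hzero] with x hx
  exact tsub_eq_zero_iff_le.1 hx

/-- Poincaré's inequality for a member of `W₀^{1,p}(Ω)`, in an exponent `q` unrelated to `p`: the
function inherits the integrability of its gradient. -/
theorem IsW01pPair.eLpNorm_le_eLpNorm_grad {p : ℝ≥0∞} (hp : 1 < p) (hp' : p ≠ ⊤)
    {y : Eucl N → ℝ} {g : Eucl N → Eucl N} (h : IsW01pPair Ω p y g) (hg : StronglyMeasurable g)
    (hy : StronglyMeasurable y) (hN : 1 ≤ N)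
    (hΩm : MeasurableSet Ω) {R : ℝ} (hΩ : Ω ⊆ Metric.ball 0 R) {q : ℝ≥0∞} (hq : 1 < q)
    (hq' : q ≠ ⊤) :
    eLpNorm y q (volume.restrict Ω)
      ≤ ENNReal.ofReal (2 * R) * eLpNorm g q (volume.restrict Ω) := by
  have he : ‖(EuclideanSpace.single (⟨0, hN⟩ : Fin N) (1 : ℝ) : Eucl N)‖ = 1 := by simp
  refine (eLpNorm_mono_enorm_ae (g := fun x => ∫⁻ t in Ioc 0 (2 * R), ‖Ω.indicator g
    (x + t • (EuclideanSpace.single (⟨0, hN⟩ : Fin N) (1 : ℝ) : Eucl N))‖ₑ)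
    ((h.enorm_le_lintegral hp hp' hg hy hΩm hΩ he).mono fun x hx => by simpa using hx)).trans ?_
  refine (eLpNorm_mono_measure _ Measure.restrict_le_self).trans
    ((eLpNorm_lintegral_line_le hq hq' (hg.indicator hΩm).enorm _ _).trans ?_)
  rw [eLpNorm_enorm_indicator_eq_restrict hΩm]

/-! ### Weak gradients: extension by zero, products, mollification -/

theorem gradient_mul_fun {φ ψ : Eucl N → ℝ} {x : Eucl N} (h : DifferentiableAt ℝ φ x)
    (h' : DifferentiableAt ℝ ψ x) :
    gradient (fun z => φ z * ψ z) x = φ x • gradient ψ x + ψ x • gradient φ x := by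
  simp only [gradient]
  rw [fderiv_fun_mul h h']
  simp

theorem continuous_gradient_of_contDiff {ψ : Eucl N → ℝ} (h : ContDiff ℝ ∞ ψ) :
    Continuous (gradient ψ) :=
  (InnerProductSpace.toDual ℝ (Eucl N)).symm.continuous.comp (h.continuous_fderiv (by simp))

theorem IsTestFunction.mul_contDiff {φ ψ : Eucl N → ℝ} (hφ : IsTestFunction Ω φ)
    (hψ : ContDiff ℝ ∞ ψ) : IsTestFunction Ω (fun x => φ x * ψ x) where
  contDiff := hφ.contDiff.mul hψ
  hasCompactSupport := hφ.hasCompactSupport.mul_right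
  tsupport_subset := (tsupport_mul_subset_left).trans hφ.tsupport_subset

theorem integral_smul_gradient_add {φ χ : Eucl N → ℝ} (hφ : IsTestFunction univ φ)
    (hχ : IsTestFunction univ χ) :
    ∫ x, (φ x • gradient χ x + χ x • gradient φ x) = 0 := by
  have hi : ∀ {a b : Eucl N → ℝ}, IsTestFunction univ a → IsTestFunction univ b →
      Integrable (fun x => a x • gradient b x) volume := fun ha hb =>
    (ha.contDiff.continuous.smul hb.continuous_gradient).integrable_of_hasCompactSupport
      hb.hasCompactSupport_gradient.smul_left
  rw [integral_add (hi hφ hχ) (hi hχ hφ)]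
  refine ext_inner_left ℝ fun v => ?_
  rw [inner_add_right, inner_zero_right, ← integral_inner (hi hφ hχ), ← integral_inner (hi hχ hφ)]
  simp only [inner_smul_right, inner_gradient_right, conj_trivial]
  have hm : ∀ {a b : Eucl N → ℝ}, IsTestFunction univ a → IsTestFunction univ b →
      Integrable (fun x => a x * fderiv ℝ b x v) volume := fun ha hb => by
    simpa only [inner_smul_right, inner_gradient_right, conj_trivial] using
      (hi ha hb).const_inner (𝕜 := ℝ) v
  have h := integral_mul_fderiv_eq_neg_fderiv_mul_of_integrable (μ := volume) (v := v)
    (f := φ) (g := χ) (by simpa only [mul_comm] using hm hχ hφ) (hm hφ hχ)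
    ((hφ.contDiff.continuous.mul hχ.contDiff.continuous).integrable_of_hasCompactSupport
      hχ.hasCompactSupport.mul_left) (fun x _ => hφ.differentiable x)
    (fun x _ => hχ.differentiable x)
  rw [h]
  simp only [mul_comm]
  simp

theorem IsTestFunction.mono {Ω' : Set (Eucl N)} {φ : Eucl N → ℝ} (h : IsTestFunction Ω φ)
    (hs : Ω ⊆ Ω') : IsTestFunction Ω' φ :=
  ⟨h.contDiff, h.hasCompactSupport, h.tsupport_subset.trans hs⟩

/-- The extension by zero of a member of `W₀^{1,p}(Ω)` is weakly differentiable on the whole space,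
and its gradient is the extension by zero. -/
theorem IsW01pPair.hasWeakGradient_indicator {p : ℝ≥0∞} (hp : 1 ≤ p) {y : Eucl N → ℝ}
    {g : Eucl N → Eucl N} (h : IsW01pPair Ω p y g) (hΩm : MeasurableSet Ω)
    (hΩf : volume Ω ≠ ⊤) :
    HasWeakGradient univ (Ω.indicator y) (Ω.indicator g) := by
  intro χ hχ
  have hfin : IsFiniteMeasure (volume.restrict Ω) := ⟨by simpa using hΩf.lt_top⟩
  have e1 : (fun x => Ω.indicator y x • gradient χ x)
      = Ω.indicator fun x => y x • gradient χ x := by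
    ext1 x; by_cases hx : x ∈ Ω <;> simp [hx]
  have e2 : (fun x => χ x • Ω.indicator g x) = Ω.indicator fun x => χ x • g x := by
    ext1 x; by_cases hx : x ∈ Ω <;> simp [hx]
  rw [Measure.restrict_univ, e1, e2, integral_indicator hΩm, integral_indicator hΩm,
    eq_neg_iff_add_eq_zero]
  have i1 : Integrable (fun x => y x • gradient χ x) (volume.restrict Ω) :=
    (h.memLp.locallyIntegrable hp).integrable_smul_right_of_hasCompactSupport
      hχ.continuous_gradient hχ.hasCompactSupport_gradient
  have i2 : Integrable (fun x => χ x • g x) (volume.restrict Ω) :=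
    (h.memLp_grad.locallyIntegrable hp).integrable_smul_left_of_hasCompactSupport
      hχ.contDiff.continuous hχ.hasCompactSupport
  obtain ⟨C₁, hC₁⟩ := hχ.hasCompactSupport.exists_bound_of_continuous hχ.contDiff.continuous
  obtain ⟨C₂, hC₂⟩ :=
    hχ.hasCompactSupport_gradient.exists_bound_of_continuous hχ.continuous_gradient
  set m : ℝ≥0∞ := volume Ω ^ (1 / (1 : ℝ≥0∞).toReal - 1 / p.toReal) with hm
  have hmt : m ≠ ⊤ := by
    rw [hm]
    refine ENNReal.rpow_ne_top_of_nonneg ?_ hΩf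
    rcases eq_or_ne p ⊤ with rfl | hpt
    · simp
    · have : 1 ≤ p.toReal := by
        simpa using (ENNReal.toReal_le_toReal ENNReal.one_ne_top hpt).2 hp
      simpa using inv_le_one_of_one_le₀ this
  have hle : ∀ δ : ℝ≥0∞, 0 < δ →
      ‖(∫ x in Ω, y x • gradient χ x) + ∫ x in Ω, χ x • g x‖ₑ
        ≤ ENNReal.ofReal C₂ * m * δ + ENNReal.ofReal C₁ * m * δ := fun δ hδ => by
    obtain ⟨φ, hφ, h1, h2⟩ := h.approx δ hδ
    have i3 : Integrable (fun x => φ x • gradient χ x) (volume.restrict Ω) :=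
      ((hφ.contDiff.continuous.smul hχ.continuous_gradient).integrable_of_hasCompactSupport
        hχ.hasCompactSupport_gradient.smul_left).integrableOn
    have i4 : Integrable (fun x => χ x • gradient φ x) (volume.restrict Ω) :=
      ((hχ.contDiff.continuous.smul hφ.continuous_gradient).integrable_of_hasCompactSupport
        hφ.hasCompactSupport_gradient.smul_left).integrableOn
    -- the same expression with the test function `φ` in place of `y` vanishes
    have hz : ∫ x in Ω, (φ x • gradient χ x + χ x • gradient φ x) = 0 := by
      rw [setIntegral_eq_integral_of_forall_compl_eq_zero,
        integral_smul_gradient_add (hφ.mono (subset_univ _)) hχ]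
      intro x hx
      rw [image_eq_zero_of_notMem_tsupport fun hx' => hx (hφ.tsupport_subset hx'),
        hφ.gradient_eq_zero hx]
      simp
    have e : (∫ x in Ω, y x • gradient χ x) + ∫ x in Ω, χ x • g x
        = ∫ x in Ω, ((y x - φ x) • gradient χ x + χ x • (g x - gradient φ x)) := by
      rw [← sub_zero ((∫ x in Ω, y x • gradient χ x) + ∫ x in Ω, χ x • g x), ← hz,
        ← integral_add i1 i2, ← integral_sub (by exact i1.add i2) (by exact i3.add i4)]
      refine integral_congr_ae (Eventually.of_forall fun x => ?_)
      simp only [sub_smul, smul_sub]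
      abel
    have hL1 : ∀ {F : Type} [NormedAddCommGroup F] {w : Eucl N → F},
        AEStronglyMeasurable w (volume.restrict Ω) → eLpNorm w p (volume.restrict Ω) < δ →
        ∫⁻ x in Ω, ‖w x‖ₑ ≤ m * δ := fun {F} _ {w} hw hwδ => by
      rw [← eLpNorm_one_eq_lintegral_enorm, mul_comm]
      refine (eLpNorm_le_eLpNorm_mul_rpow_measure_univ hp hw).trans ?_
      rw [Measure.restrict_apply_univ]
      gcongr
    have hyφ : AEStronglyMeasurable (fun x => y x - φ x) (volume.restrict Ω) :=
      h.memLp.1.sub hφ.contDiff.continuous.aestronglyMeasurable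
    have hgφ : AEStronglyMeasurable (fun x => g x - gradient φ x) (volume.restrict Ω) :=
      h.memLp_grad.1.sub hφ.continuous_gradient.aestronglyMeasurable
    rw [e]
    calc _ ≤ ∫⁻ x in Ω, ‖(y x - φ x) • gradient χ x + χ x • (g x - gradient φ x)‖ₑ :=
          enorm_integral_le_lintegral_enorm _
      _ ≤ ∫⁻ x in Ω, (ENNReal.ofReal C₂ * ‖y x - φ x‖ₑ
            + ENNReal.ofReal C₁ * ‖g x - gradient φ x‖ₑ) := by
          refine lintegral_mono fun x => (enorm_add_le _ _).trans ?_
          rw [enorm_smul, enorm_smul, mul_comm ‖y x - φ x‖ₑ]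
          gcongr
          · rw [← ofReal_norm]; exact ENNReal.ofReal_le_ofReal (hC₂ x)
          · rw [← ofReal_norm]; exact ENNReal.ofReal_le_ofReal (hC₁ x)
      _ = ENNReal.ofReal C₂ * (∫⁻ x in Ω, ‖y x - φ x‖ₑ)
            + ENNReal.ofReal C₁ * ∫⁻ x in Ω, ‖g x - gradient φ x‖ₑ := by
          rw [lintegral_add_left' (hyφ.enorm.const_mul _), lintegral_const_mul' _ _ (by simp),
            lintegral_const_mul' _ _ (by simp)]
      _ ≤ _ := by
          rw [mul_assoc, mul_assoc]
          gcongr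
          · exact hL1 hyφ h1
          · exact hL1 hgφ h2
  have ht : Tendsto (fun δ : ℝ≥0∞ => ENNReal.ofReal C₂ * m * δ + ENNReal.ofReal C₁ * m * δ)
      (𝓝[>] 0) (𝓝 0) := by
    have : Continuous fun δ : ℝ≥0∞ => ENNReal.ofReal C₂ * m * δ + ENNReal.ofReal C₁ * m * δ :=
      (ENNReal.continuous_const_mul (ENNReal.mul_ne_top (by simp) hmt)).add
        (ENNReal.continuous_const_mul (ENNReal.mul_ne_top (by simp) hmt))
    simpa using (this.tendsto 0).mono_left nhdsWithin_le_nhds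
  have := le_antisymm (ge_of_tendsto ht (eventually_mem_nhdsWithin.mono hle)) bot_le
  simpa using this

theorem HasWeakGradient.smul_contDiff {u : Eucl N → ℝ} {G : Eucl N → Eucl N}
    (h : HasWeakGradient Ω u G) (hu : LocallyIntegrable u (volume.restrict Ω))
    (hG : LocallyIntegrable G (volume.restrict Ω)) {ψ : Eucl N → ℝ} (hψ : ContDiff ℝ ∞ ψ) :
    HasWeakGradient Ω (fun x => ψ x * u x) (fun x => ψ x • G x + u x • gradient ψ x) := by
  intro φ hφ
  have hφψ := hφ.mul_contDiff hψ
  have hψd : Differentiable ℝ ψ := hψ.differentiable (by simp)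
  have i1 : Integrable (fun x => u x • gradient (fun z => φ z * ψ z) x) (volume.restrict Ω) :=
    hu.integrable_smul_right_of_hasCompactSupport hφψ.continuous_gradient
      hφψ.hasCompactSupport_gradient
  have i2 : Integrable (fun x => u x • (φ x • gradient ψ x)) (volume.restrict Ω) :=
    hu.integrable_smul_right_of_hasCompactSupport
      (hφ.contDiff.continuous.smul (continuous_gradient_of_contDiff hψ))
      hφ.hasCompactSupport.smul_right
  have i3 : Integrable (fun x => (φ x * ψ x) • G x) (volume.restrict Ω) :=
    hG.integrable_smul_left_of_hasCompactSupport hφψ.contDiff.continuous hφψ.hasCompactSupport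
  have e1 : (fun x => (ψ x * u x) • gradient φ x)
      = fun x => u x • gradient (fun z => φ z * ψ z) x - u x • (φ x • gradient ψ x) := by
    ext1 x
    rw [gradient_mul_fun (hφ.differentiable x) (hψd x), smul_add, add_sub_cancel_left, smul_smul,
      mul_comm]
  have e2 : (fun x => φ x • (ψ x • G x + u x • gradient ψ x))
      = fun x => (φ x * ψ x) • G x + u x • (φ x • gradient ψ x) := by
    ext1 x
    rw [smul_add, smul_smul, smul_comm (φ x) (u x)]
  rw [e1, e2, integral_sub i1 i2, integral_add i3 i2, h _ hφψ]
  abel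

theorem contDiff_mollify {u : Eucl N → ℝ} (hu : LocallyIntegrable u volume) {η : Eucl N → ℝ}
    (hη : ContDiff ℝ ∞ η) (hηs : HasCompactSupport η) :
    ContDiff ℝ ∞ fun x => ∫ z, η z • u (x - z) :=
  hηs.contDiff_convolution_left (ContinuousLinearMap.lsmul ℝ ℝ) hη hu

/-- Mollification commutes with weak differentiation: `z ↦ η (x - z)` is an admissible test
function. -/
theorem HasWeakGradient.gradient_mollify {u : Eucl N → ℝ} {G : Eucl N → Eucl N}
    (h : HasWeakGradient univ u G) (hu : LocallyIntegrable u volume) {η : Eucl N → ℝ}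
    (hη : ContDiff ℝ ∞ η) (hηs : HasCompactSupport η) (x : Eucl N) :
    gradient (fun x => ∫ z, η z • u (x - z)) x = ∫ z, η z • G (x - z) := by
  have hη1 : ContDiff ℝ 1 η := hη.of_le (by simp)
  have hηd : Differentiable ℝ η := hη.differentiable (by simp)
  have hφ : IsTestFunction univ fun s => η (x - s) := by
    refine ⟨hη.comp (contDiff_const.sub contDiff_id), ?_, subset_univ _⟩
    exact hηs.comp_homeomorph (Homeomorph.subLeft x)
  have hgφ : ∀ s, gradient (fun s => η (x - s)) s = -gradient η (x - s) := fun s => by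
    have h1 : HasFDerivAt (fun s => η (x - s))
        ((fderiv ℝ η (x - s)).comp (-ContinuousLinearMap.id ℝ (Eucl N))) s :=
      (hηd (x - s)).hasFDerivAt.comp s ((hasFDerivAt_id s).const_sub x)
    simp only [gradient]
    rw [h1.fderiv, ContinuousLinearMap.comp_neg, ContinuousLinearMap.comp_id, map_neg]
  have hw := h _ hφ
  simp only [Measure.restrict_univ, hgφ, smul_neg, integral_neg, neg_inj] at hw
  have e2 : ∫ z, η z • G (x - z) = ∫ s, η (x - s) • G s := by
    rw [← integral_sub_left_eq_self (fun z => η z • G (x - z)) volume x]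
    simp
  rw [e2, ← hw]
  refine ext_inner_left ℝ fun v => ?_
  have hgη : HasCompactSupport (gradient η) :=
    (⟨hη, hηs, subset_univ _⟩ : IsTestFunction univ η).hasCompactSupport_gradient
  have hint : Integrable (fun s => u s • gradient η (x - s)) volume :=
    hu.integrable_smul_right_of_hasCompactSupport
      ((continuous_gradient_of_contDiff hη).comp (continuous_const.sub continuous_id))
      (hgη.comp_homeomorph (Homeomorph.subLeft x))
  rw [inner_gradient_right, conj_trivial, ← integral_inner hint]
  simp only [inner_smul_right, inner_gradient_right, conj_trivial]
  have hF := hηs.hasFDerivAt_convolution_left (ContinuousLinearMap.lsmul ℝ ℝ) (μ := volume) hη1 hu x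
  have hF' : fderiv ℝ (fun x => ∫ z, η z • u (x - z)) x
      = (convolution (fderiv ℝ η) u ((ContinuousLinearMap.lsmul ℝ ℝ).precompL (Eucl N)) volume) x :=
    hF.fderiv
  have hx := (hηs.fderiv ℝ).convolutionExists_left
    ((ContinuousLinearMap.lsmul ℝ ℝ).precompL (Eucl N))
    (hη1.continuous_fderiv one_ne_zero) hu x
  rw [hF', convolution_def, ContinuousLinearMap.integral_apply hx,
    ← integral_sub_left_eq_self (fun s => u s * fderiv ℝ η (x - s) v) volume x]
  simp [ContinuousLinearMap.precompL_apply, mul_comm]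

/-! ### Approximation up to a Lipschitz boundary -/

theorem HasWeakGradient.of_univ {u : Eucl N → ℝ} {G : Eucl N → Eucl N}
    (h : HasWeakGradient univ u G) : HasWeakGradient Ω u G := by
  intro φ hφ
  have h1 := h φ (hφ.mono (subset_univ _))
  rw [Measure.restrict_univ] at h1
  rw [setIntegral_eq_integral_of_forall_compl_eq_zero,
    setIntegral_eq_integral_of_forall_compl_eq_zero, h1]
  · intro x hx
    simp [image_eq_zero_of_notMem_tsupport fun hx' => hx (hφ.tsupport_subset hx')]
  · intro x hx
    simp [hφ.gradient_eq_zero hx]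

open scoped Pointwise in
/-- A compactly supported Sobolev function whose support can be pushed into `Ω` along a direction
`e`, with a margin proportional to the displacement, belongs to `W₀^{1,p}(Ω)`: mollify it with
kernels supported in the ball of radius `c τ` around `τ e`. -/
theorem isW01pPair_of_closedBall_subset {p : ℝ≥0∞} (hp : 1 < p) (hp' : p ≠ ⊤) {u : Eucl N → ℝ}
    {G : Eucl N → Eucl N} (hum : StronglyMeasurable u) (hGm : StronglyMeasurable G)
    (hu : MemLp u p volume) (hG : MemLp G p volume) (hw : HasWeakGradient univ u G)
    {K : Set (Eucl N)} (hK : IsCompact K) (huK : ∀ x, x ∉ K → u x = 0)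
    {e : Eucl N} (he : ‖e‖ ≤ 1) {c ρ : ℝ} (hc : 0 < c) (hc1 : c ≤ 1) (hρ : 0 < ρ)
    (hcone : ∀ x ∈ K, ∀ τ : ℝ, 0 < τ → τ < ρ → Metric.closedBall (x + τ • e) (c * τ) ⊆ Ω) :
    IsW01pPair Ω p u G where
  memLp := hu.restrict _
  memLp_grad := hG.restrict _
  weakGradient := hw.of_univ
  approx δ hδ := by
    obtain ⟨δ', hδ'0, hδ'⟩ := exists_between hδ
    obtain ⟨r₁, hr₁, H₁⟩ := exists_eLpNorm_mollify_sub_le hp hp' hum hu hδ'0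
    obtain ⟨r₂, hr₂, H₂⟩ := exists_eLpNorm_mollify_sub_le hp hp' hGm hG hδ'0
    obtain ⟨τ, hτ0, hτ⟩ := exists_between (lt_min hρ (half_pos (lt_min hr₁ hr₂)))
    have hτρ : τ < ρ := hτ.trans_le (min_le_left _ _)
    have hτr : 2 * τ < min r₁ r₂ := by
      have := hτ.trans_le (min_le_right _ _); linarith
    -- the kernel is supported in the ball of radius `c * τ` around the shifted centre `τ • e`
    let b : ContDiffBump (τ • e) :=
      ⟨c * τ / 2, c * τ, by positivity, by have := mul_pos hc hτ0; linarith⟩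
    set η : Eucl N → ℝ := b.normed volume with hη
    have hηc : ContDiff ℝ ∞ η := b.contDiff_normed
    have hηs : HasCompactSupport η := b.hasCompactSupport_normed
    have hsupp : ∀ z, η z ≠ 0 → z ∈ Metric.ball (τ • e) (c * τ) := fun z hz => by
      have : z ∈ Function.support (b.normed volume) := hz
      rwa [b.support_normed_eq] at this
    have hsmall : ∀ z, η z ≠ 0 → ‖z‖ < min r₁ r₂ := fun z hz => by
      have h1 : ‖z - τ • e‖ < c * τ := by simpa [dist_eq_norm] using hsupp z hz
      have h2 : ‖τ • e‖ ≤ τ := by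
        rw [norm_smul, Real.norm_of_nonneg hτ0.le]
        exact mul_le_of_le_one_right hτ0.le he
      have h3 : ‖z‖ ≤ ‖z - τ • e‖ + ‖τ • e‖ := by simpa using norm_add_le (z - τ • e) (τ • e)
      have h4 : c * τ ≤ τ := mul_le_of_le_one_left hτ0.le hc1
      linarith
    have hul : LocallyIntegrable u volume := hu.locallyIntegrable hp.le
    set v : Eucl N → ℝ := fun x => ∫ z, η z • u (x - z) with hv
    set K' : Set (Eucl N) := K + Metric.closedBall (τ • e) (c * τ) with hK'
    have hK'c : IsCompact K' := hK.add (isCompact_closedBall _ _)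
    have hvK' : Function.support v ⊆ K' := fun x hx => by
      by_contra hx'
      refine hx ?_
      simp only [hv]
      refine integral_eq_zero_of_ae (Eventually.of_forall fun z => ?_)
      by_contra hz
      simp only [Pi.zero_apply, smul_eq_mul, mul_eq_zero, not_or] at hz
      refine hx' ⟨x - z, by_contra fun h => hz.2 (huK _ h), z,
        Metric.ball_subset_closedBall (hsupp z hz.1), by simp⟩
    have hK'Ω : K' ⊆ Ω := by
      rintro _ ⟨x, hx, z, hz, rfl⟩
      refine hcone x hx τ hτ0 hτρ ?_
      simpa [dist_eq_norm, add_sub_add_left_eq_sub] using hz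
    have hvt : tsupport v ⊆ K' := closure_minimal hvK' hK'c.isClosed
    refine ⟨v, ⟨contDiff_mollify hul hηc hηs, hK'c.of_isClosed_subset (isClosed_tsupport v) hvt,
      hvt.trans hK'Ω⟩, ?_, ?_⟩
    · refine (eLpNorm_mono_measure _ Measure.restrict_le_self).trans_lt (lt_of_le_of_lt ?_ hδ')
      exact H₁ η hηc.continuous (fun z => b.nonneg_normed z) (b.integral_normed)
        fun z hz => (hsmall z hz).trans_le (min_le_left _ _)
    · simp only [hv, hw.gradient_mollify hul hηc hηs]
      refine (eLpNorm_mono_measure _ Measure.restrict_le_self).trans_lt (lt_of_le_of_lt ?_ hδ')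
      exact H₂ η hηc.continuous (fun z => b.nonneg_normed z) (b.integral_normed)
        fun z hz => (hsmall z hz).trans_le (min_le_right _ _)

/-- The uniform interior cone condition, locally near every point of the closure. At a boundary
point the direction is the vertical one of the epigraph; at an interior point `e = 0` serves. -/
theorem HasLipschitzBoundary.exists_cone (h : HasLipschitzBoundary Ω) (hΩ : IsOpen Ω)
    {x₀ : Eucl N} (hx₀ : x₀ ∈ closure Ω) :
    ∃ e : Eucl N, ‖e‖ ≤ 1 ∧ ∃ c : ℝ, 0 < c ∧ c ≤ 1 ∧ ∃ ρ : ℝ, 0 < ρ ∧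
      ∀ x ∈ closure Ω ∩ Metric.ball x₀ ρ, ∀ τ : ℝ, 0 < τ → τ < ρ →
        Metric.closedBall (x + τ • e) (c * τ) ⊆ Ω := by
  by_cases hx : x₀ ∈ Ω
  · obtain ⟨r, hr, hball⟩ := Metric.isOpen_iff.1 hΩ x₀ hx
    refine ⟨0, by simp, 1, one_pos, le_rfl, r / 2, half_pos hr, ?_⟩
    rintro x ⟨-, hx1⟩ τ hτ0 hτ z hz
    rw [smul_zero, add_zero, one_mul, Metric.mem_closedBall] at hz
    refine hball ?_
    have h1 := dist_triangle z x x₀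
    rw [Metric.mem_ball] at hx1 ⊢
    linarith
  · have hfr : x₀ ∈ frontier Ω := ⟨hx₀, by rwa [hΩ.interior_eq]⟩
    obtain ⟨e, he, h, L, hL, r, hr, hgraph⟩ := h x₀ hfr
    set P := (Submodule.span ℝ {e})ᗮ.orthogonalProjectionOnto with hP
    have hPn : ∀ z, ‖P z‖ ≤ ‖z‖ := fun z => Submodule.norm_orthogonalProjectionOnto_apply_le _ z
    have hPe : P e = 0 := by
      rw [hP, Submodule.orthogonalProjectionOnto_eq_zero_iff, Submodule.orthogonal_orthogonal]
      exact Submodule.mem_span_singleton_self e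
    have hLp : (0 : ℝ) < 2 * (L + 1) := by positivity
    have hL0 : (0 : ℝ) ≤ L := L.2
    refine ⟨e, he.le, 1 / (2 * (L + 1)), by positivity, ?_, r / 4, by positivity, ?_⟩
    · rw [div_le_one hLp]; linarith
    rintro x ⟨hxc, hx1⟩ τ hτ0 hτ z hz
    rw [Metric.mem_ball] at hx1
    have hxr : x ∈ Metric.ball x₀ r := by rw [Metric.mem_ball]; linarith
    -- at a point of the closure the strict epigraph inequality survives as a weak one
    have hle : h (P x) ≤ inner ℝ e x := by
      have hev : ∃ᶠ x' in 𝓝 x, h (P x') ≤ inner ℝ e x' := by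
        refine ((mem_closure_iff_frequently.1 hxc).and_eventually
          (Metric.isOpen_ball.mem_nhds hxr)).mono ?_
        rintro x' ⟨h1, h2⟩
        exact ((hgraph x' h2).1 h1).le
      have hcl : IsClosed {x' | h (P x') ≤ inner ℝ e x'} :=
        isClosed_le (hL.continuous.comp P.continuous) (continuous_const.inner continuous_id)
      exact hcl.closure_subset (mem_closure_iff_frequently.2 hev)
    set d : Eucl N := z - (x + τ • e) with hd
    have hzd : z = x + τ • e + d := by rw [hd]; abel
    have hdn : ‖d‖ ≤ 1 / (2 * (L + 1)) * τ := by
      simpa [hd, dist_eq_norm] using hz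
    have hdn2 : (L + 1) * ‖d‖ ≤ τ / 2 := by
      calc (L + 1) * ‖d‖ ≤ (L + 1) * (1 / (2 * (L + 1)) * τ) := by gcongr
        _ = τ / 2 := by field_simp
    have hdτ : ‖d‖ ≤ τ / 2 := by nlinarith [norm_nonneg d]
    have hzr : z ∈ Metric.ball x₀ r := by
      have h1 : dist z x ≤ τ + τ / 2 := by
        rw [dist_eq_norm, hzd, add_assoc, add_sub_cancel_left]
        refine (norm_add_le _ _).trans ?_
        rw [norm_smul, he, Real.norm_of_nonneg hτ0.le, mul_one]
        linarith
      have h2 := dist_triangle z x x₀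
      rw [Metric.mem_ball]
      linarith
    rw [hgraph z hzr]
    have hPz : P z = P x + P d := by rw [hzd, map_add, map_add, map_smul, hPe]; simp
    have h1 : h (P z) ≤ h (P x) + L * ‖d‖ := by
      have h2 := hL.dist_le_mul (P z) (P x)
      rw [hPz, dist_eq_norm, dist_eq_norm, add_sub_cancel_left, ← hPz] at h2
      have h3 := (le_abs_self _).trans h2
      have h4 := mul_le_mul_of_nonneg_left (hPn d) hL0
      linarith
    have h5 : inner ℝ e z = inner ℝ e x + τ + inner ℝ e d := by
      rw [hzd, inner_add_right, inner_add_right, inner_smul_right, real_inner_self_eq_norm_sq, he]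
      ring
    have h6 : -‖d‖ ≤ inner ℝ e d := by
      have := (abs_le.1 (abs_real_inner_le_norm e d)).1
      rwa [he, one_mul] at this
    change h (P z) < _
    rw [h5]
    have h7 : (L + 1) * ‖d‖ = L * ‖d‖ + ‖d‖ := by ring
    linarith

/-- On a bounded open set with Lipschitz boundary, `W₀^{1,q} ∩ W^{1,p} ⊆ W₀^{1,p}`. The Lipschitz
boundary is essential: removing a point from a disc is invisible to `W₀^{1,2}` but not to
`W₀^{1,p}` for `p > 2`. -/
theorem IsW01pPair.isW01pPair_of_memLp {q p : ℝ≥0∞} (hq : 1 ≤ q) (hp : 1 < p) (hp' : p ≠ ⊤)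
    (hΩ : IsOpen Ω) (hΩb : Bornology.IsBounded Ω) (hΩL : HasLipschitzBoundary Ω) {y : Eucl N → ℝ}
    {g : Eucl N → Eucl N} (hym : StronglyMeasurable y) (hgm : StronglyMeasurable g)
    (h : IsW01pPair Ω q y g) (hy : MemLp y p (volume.restrict Ω))
    (hg : MemLp g p (volume.restrict Ω)) : IsW01pPair Ω p y g := by
  have hΩm : MeasurableSet Ω := hΩ.measurableSet
  have hglob := h.hasWeakGradient_indicator hq hΩm hΩb.measure_lt_top.ne
  set u : Eucl N → ℝ := Ω.indicator y with hu
  set G : Eucl N → Eucl N := Ω.indicator g with hG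
  have hum : StronglyMeasurable u := hym.indicator hΩm
  have hGm : StronglyMeasurable G := hgm.indicator hΩm
  have huL : MemLp u p volume := (memLp_indicator_iff_restrict hΩm).2 hy
  have hGL : MemLp G p volume := (memLp_indicator_iff_restrict hΩm).2 hg
  have hul : LocallyIntegrable u volume := huL.locallyIntegrable hp.le
  have hGl : LocallyIntegrable G volume := hGL.locallyIntegrable hp.le
  -- `Q ψ` says that the cut-off `ψ y` belongs to `W₀^{1,p}(Ω)`
  let Q : (Eucl N → ℝ) → Prop := fun ψ =>
    IsW01pPair Ω p (fun x => ψ x * y x) (fun x => ψ x • g x + y x • gradient ψ x)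
  have hcone : ∀ x₀ : closure Ω, ∃ ρ : ℝ, 0 < ρ ∧ ∀ ψ : Eucl N → ℝ, ContDiff ℝ ∞ ψ →
      HasCompactSupport ψ → tsupport ψ ⊆ Metric.ball x₀ ρ → Q ψ := fun ⟨x₀, hx₀⟩ => by
    obtain ⟨e, he, c, hc, hc1, ρ, hρ, hcone⟩ := hΩL.exists_cone hΩ hx₀
    refine ⟨ρ, hρ, fun ψ hψ hψs hψt => ?_⟩
    have hψ' := continuous_gradient_of_contDiff hψ
    have hψs' : HasCompactSupport (gradient ψ) :=
      (⟨hψ, hψs, subset_univ _⟩ : IsTestFunction univ ψ).hasCompactSupport_gradient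
    obtain ⟨C₁, hC₁⟩ := hψs.exists_bound_of_continuous hψ.continuous
    obtain ⟨C₂, hC₂⟩ := hψs'.exists_bound_of_continuous hψ'
    have m1 : MemLp (fun x => ψ x * u x) p volume :=
      huL.of_le_mul (c := C₁) (hψ.continuous.aestronglyMeasurable.mul huL.1)
        (Eventually.of_forall fun x => by
          rw [norm_mul]; exact mul_le_mul_of_nonneg_right (hC₁ x) (norm_nonneg _))
    have m2 : MemLp (fun x => ψ x • G x) p volume :=
      hGL.of_le_mul (c := C₁) (hψ.continuous.aestronglyMeasurable.smul hGL.1)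
        (Eventually.of_forall fun x => by
          rw [norm_smul]; exact mul_le_mul_of_nonneg_right (hC₁ x) (norm_nonneg _))
    have m3 : MemLp (fun x => u x • gradient ψ x) p volume :=
      huL.of_le_mul (c := C₂) (huL.1.smul hψ'.aestronglyMeasurable)
        (Eventually.of_forall fun x => by
          rw [norm_smul, mul_comm]; exact mul_le_mul_of_nonneg_right (hC₂ x) (norm_nonneg _))
    have hw := hglob.smul_contDiff (by simpa using hul) (by simpa using hGl) hψ
    have hres : IsW01pPair Ω p (fun x => ψ x * u x)
        (fun x => ψ x • G x + u x • gradient ψ x) := by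
      refine isW01pPair_of_closedBall_subset hp hp' (hψ.continuous.stronglyMeasurable.mul hum)
        ((hψ.continuous.stronglyMeasurable.smul hGm).add (hum.smul hψ'.stronglyMeasurable))
        m1 (m2.add m3) hw (K := closure Ω ∩ tsupport ψ) (hψs.isCompact.inter_left isClosed_closure)
        ?_ he hc hc1 hρ (fun x hx => hcone x ⟨hx.1, hψt hx.2⟩)
      intro x hx
      by_cases hxΩ : x ∈ Ω
      · have : x ∉ tsupport ψ := fun h' => hx ⟨subset_closure hxΩ, h'⟩
        simp [image_eq_zero_of_notMem_tsupport this]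
      · simp [hu, hxΩ]
    refine hres.congr ?_ ?_ <;>
    · filter_upwards [ae_restrict_mem hΩm] with x hx
      simp [hu, hG, hx]
  choose ρ hρ hloc using hcone
  have hQadd : ∀ {a b : Eucl N → ℝ}, ContDiff ℝ ∞ a → ContDiff ℝ ∞ b → Q a → Q b →
      Q (fun x => a x + b x) := fun {a b} ha hb hQa hQb => by
    refine (hQa.add hp.le hQb).congr ?_ ?_ <;> refine Eventually.of_forall fun x => ?_
    · simp [add_mul]
    · have := gradient_add_fun (ha.differentiable (by simp)) (hb.differentiable (by simp)) x
      change _ = (a x + b x) • g x + y x • gradient (a + b) x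
      rw [this]
      simp only [Pi.add_apply, add_smul, smul_add]
      abel
  let χ : ∀ x₀ : closure Ω, ContDiffBump (x₀ : Eucl N) := fun x₀ =>
    ⟨ρ x₀ / 4, ρ x₀ / 2, by linarith [hρ x₀], by linarith [hρ x₀]⟩
  -- `1 - ∏ (1 - χ i)` is a sum of functions each supported near one centre, and it equals `1`
  -- wherever some `χ i` does
  let Θ : Finset (closure Ω) → Eucl N → ℝ := fun s x => ∏ i ∈ s, (1 - χ i x)
  have hΘc : ∀ s, ContDiff ℝ ∞ (Θ s) := fun s =>
    contDiff_prod fun i _ => contDiff_const.sub (χ i).contDiff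
  have hQΘ : ∀ s, Q (fun x => 1 - Θ s x) := fun s => by
    induction s using Finset.cons_induction with
    | empty =>
      refine (IsW01pPair.zero (Ω := Ω) (p := p)).congr ?_ ?_ <;>
      refine Eventually.of_forall fun x => ?_
      · simp [Θ]
      · have : (fun x => 1 - Θ ∅ x) = fun _ : Eucl N => (0 : ℝ) := by ext; simp [Θ]
        simp only [this]
        simp [Θ]
    | cons j s hj ih =>
      have e1 : (fun x => 1 - Θ (Finset.cons j s hj) x)
          = fun x => (1 - Θ s x) + χ j x * Θ s x := by
        ext x; simp only [Θ, Finset.prod_cons]; ring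
      rw [e1]
      have hs : HasCompactSupport fun x => χ j x * Θ s x := (χ j).hasCompactSupport.mul_right
      have hcd : ContDiff ℝ ∞ fun x => χ j x * Θ s x := (χ j).contDiff.mul (hΘc s)
      refine hQadd (contDiff_const.sub (hΘc s)) hcd ih (hloc j _ hcd hs ?_)
      refine tsupport_mul_subset_left.trans ?_
      rw [(χ j).tsupport_eq]
      exact Metric.closedBall_subset_ball (half_lt_self (hρ j))
  have hcomp : IsCompact (closure Ω) := hΩb.isCompact_closure
  obtain ⟨s, hs⟩ := hcomp.elim_finite_subcover
    (fun i : closure Ω => Metric.ball (i : Eucl N) (ρ i / 4)) (fun _ => Metric.isOpen_ball)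
    (fun x hx => mem_iUnion.2 ⟨⟨x, hx⟩, Metric.mem_ball_self (by linarith [hρ ⟨x, hx⟩])⟩)
  have hone : ∀ x ∈ Ω, 1 - Θ s x = 1 := fun x hx => by
    obtain ⟨i, his, hi⟩ := mem_iUnion₂.1 (hs (subset_closure hx))
    have : χ i x = 1 := (χ i).one_of_mem_closedBall (Metric.ball_subset_closedBall hi)
    rw [show Θ s x = 0 from Finset.prod_eq_zero his (by rw [this, sub_self]), sub_zero]
  refine (hQΘ s).congr ?_ ?_ <;> filter_upwards [ae_restrict_mem hΩm] with x hx
  · rw [hone x hx, one_mul]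
  · have hloc1 : (fun x => 1 - Θ s x) =ᶠ[𝓝 x] fun _ => (1 : ℝ) :=
      eventually_of_mem (hΩ.mem_nhds hx) hone
    have : gradient (fun x => 1 - Θ s x) x = 0 := by
      rw [gradient, hloc1.fderiv_eq]; simp
    rw [hone x hx, this, one_smul, smul_zero, add_zero]

end Sobolev

section Energy

variable {N k : ℕ} {Ω : Set (Eucl N)} {F : ℝ → ℝ}

/-! ### The a priori estimate -/

/-- `|M^{1/2} η|² = (Mη, η)` for a symmetric positive semidefinite `M`. -/
theorem norm_sq_toEuclideanLin_sqrt {M : Matrix (Fin N) (Fin N) ℝ} (hM : M.IsSymm)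
    (hM0 : ∀ η : Eucl N, 0 ≤ inner ℝ η (M.toEuclideanLin η)) (η : Eucl N) :
    ‖(CFC.sqrt M).toEuclideanLin η‖ ^ 2 = inner ℝ (M.toEuclideanLin η) η := by
  have hH : M.IsHermitian := by
    rw [Matrix.IsHermitian, Matrix.conjTranspose_eq_transpose_of_trivial]
    exact hM
  have hps : M.PosSemidef := by
    rw [← Matrix.isPositive_toEuclideanLin_iff]
    refine ⟨Matrix.isSymmetric_toEuclideanLin_iff.2 hH, fun x => ?_⟩
    rw [real_inner_comm]
    simpa using hM0 x
  have hS : ((CFC.sqrt M).toEuclideanLin).IsSymmetric :=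
    Matrix.isSymmetric_toEuclideanLin_iff.2 (Matrix.nonneg_iff_posSemidef.1 (CFC.sqrt_nonneg M)).1
  have hmul : (CFC.sqrt M).toEuclideanLin ((CFC.sqrt M).toEuclideanLin η) = M.toEuclideanLin η := by
    conv_rhs => rw [← CFC.sqrt_mul_sqrt_self M (Matrix.nonneg_iff_posSemidef.2 hps)]
    simp [Matrix.toLpLin_apply, Matrix.mulVec_mulVec]
  rw [← real_inner_self_eq_norm_sq, ← hmul, hS, real_inner_comm]

theorem aestronglyMeasurable_toEuclideanLin {μ : Measure (Eucl N)}
    {S : Eucl N → Matrix (Fin N) (Fin N) ℝ} (hS : ∀ i j, AEStronglyMeasurable (fun x => S x i j) μ)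
    {g : Eucl N → Eucl N} (hg : AEStronglyMeasurable g μ) :
    AEStronglyMeasurable (fun x => (S x).toEuclideanLin (g x)) μ := by
  have h : AEMeasurable (fun x => fun i => ∑ j, S x i j * g x j) μ := by
    refine aemeasurable_pi_lambda _ fun i => Finset.aemeasurable_fun_sum _ fun j _ => ?_
    exact (hS i j).aemeasurable.mul
      ((EuclideanSpace.proj (𝕜 := ℝ) j).continuous.measurable.comp_aemeasurable hg.aemeasurable)
  have h2 := (WithLp.measurable_toLp 2 (Fin N → ℝ)).comp_aemeasurable h
  exact h2.aestronglyMeasurable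

theorem IsTruncation.min_le (hF : IsTruncation k F) {t : ℝ} (ht : 0 ≤ t) :
    min t ((k : ℝ) ^ 2) ≤ F t := by
  rcases le_total t ((k : ℝ) ^ 2) with h | h
  · rw [hF.eq_self t ⟨ht, h⟩]; exact min_le_left _ _
  · refine (min_le_right _ _).trans ?_
    have h0 : (0 : ℝ) ≤ (k : ℝ) ^ 2 := sq_nonneg _
    rw [← hF.eq_self _ ⟨h0, le_rfl⟩]
    exact hF.monotoneOn h0 ht h

theorem IsTruncation.le_const (hF : IsTruncation k F) {t : ℝ} (ht : 0 ≤ t) :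
    F t ≤ (k : ℝ) ^ 2 + 1 := by
  have h1 := hF.eq_const (max t ((k : ℝ) ^ 2 + 2)) (by
    have := le_max_right t ((k : ℝ) ^ 2 + 2); linarith)
  rw [← h1]
  exact hF.monotoneOn ht (ht.trans (le_max_left _ _)) (le_max_left _ _)

theorem IsTruncation.measurable_comp {X : Type*} [MeasurableSpace X] {μ : Measure X}
    (hF : IsTruncation k F) {t : X → ℝ} (ht : AEMeasurable t μ) (ht0 : ∀ x, 0 ≤ t x) :
    AEMeasurable (fun x => F (t x)) μ := by
  have hm : Monotone fun s => F (max s 0) := fun a b hab =>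
    hF.monotoneOn (mem_Ici.2 (le_max_right _ _)) (mem_Ici.2 (le_max_right _ _))
      (max_le_max_right 0 hab)
  have h2 := hm.measurable.comp_aemeasurable ht
  refine h2.congr (Eventually.of_forall fun x => ?_)
  simp [ht0 x]

theorem IsTruncation.min_rpow_le (hF : IsTruncation k F) {p ε t : ℝ} (hp : 2 ≤ p)
    (hε : 0 < ε) (ht : 0 ≤ t) :
    min t ((k : ℝ) ^ 2) ^ (p / 2) ≤ (ε + F t) ^ ((p - 2) / 2) * t := by
  set s := min t ((k : ℝ) ^ 2) with hs
  have hs0 : 0 ≤ s := le_min ht (sq_nonneg _)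
  have hsF : s ≤ F t := hF.min_le ht
  have e : s ^ (p / 2) = s ^ ((p - 2) / 2) * s := by
    rw [← Real.rpow_add_one' hs0 (by linarith)]; congr 1; ring
  rw [e]
  exact mul_le_mul (Real.rpow_le_rpow hs0 (by linarith) (by linarith)) (min_le_left _ _) hs0
    (Real.rpow_nonneg (by linarith) _)

theorem IsTruncation.sub_one_le (hF : IsTruncation k F) (hk : 1 ≤ k) {p ε t : ℝ} (hp : 2 ≤ p)
    (hε : 0 < ε) (ht : 0 ≤ t) :
    t - 1 ≤ (ε + F t) ^ ((p - 2) / 2) * t := by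
  have hF0 : 0 ≤ F t := hF.mapsTo ht
  rcases le_total t 1 with h | h
  · have : 0 ≤ (ε + F t) ^ ((p - 2) / 2) * t :=
      mul_nonneg (Real.rpow_nonneg (by linarith) _) ht
    linarith
  · have hk1 : (1 : ℝ) ≤ (k : ℝ) ^ 2 := one_le_pow₀ (by exact_mod_cast hk)
    have h1 : 1 ≤ F t := (le_min h hk1).trans (hF.min_le ht)
    have h2 : 1 ≤ (ε + F t) ^ ((p - 2) / 2) := Real.one_le_rpow (by linarith) (by linarith)
    nlinarith

theorem integral_norm_sq_eq_norm_sq {μ : Measure (Eucl N)} {E : Type*} [NormedAddCommGroup E]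
    [InnerProductSpace ℝ E] (h : Lp E 2 μ) : ∫ x, ‖h x‖ ^ 2 ∂μ = ‖h‖ ^ 2 := by
  rw [← real_inner_self_eq_norm_sq, L2.inner_def]
  simp

theorem H01.norm_le_norm_grad (hN : 1 ≤ N) (hΩm : MeasurableSet Ω) {R : ℝ} (hR : 0 ≤ R)
    (hΩ : Ω ⊆ Metric.ball 0 R) (y : H01 Ω) : ‖y.1.1‖ ≤ 2 * R * ‖y.1.2‖ := by
  have h : IsW01pPair Ω 2 y.1.1 y.1.2 := y.2
  have h1 := h.eLpNorm_le_eLpNorm_grad (by norm_num) (by norm_num) (Lp.stronglyMeasurable _)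
    (Lp.stronglyMeasurable _) hN hΩm hΩ (q := 2) (by norm_num) (by norm_num)
  rw [Lp.norm_def, Lp.norm_def, ← ENNReal.toReal_ofReal (by positivity : 0 ≤ 2 * R),
    ← ENNReal.toReal_mul]
  exact ENNReal.toReal_mono (ENNReal.mul_ne_top ENNReal.ofReal_ne_top (Lp.eLpNorm_ne_top _)) h1

/-- The a priori estimate. With `t = |A^{1/2}∇y|²`, testing the equation with its solution bounds
`∫ t` and `∫ min(t, k²)^{p/2}` by a constant that depends neither on `ε`, `k` nor on `A`. -/
theorem IsRegularizedSolution.exists_energy_bound (hN : 1 ≤ N) (hΩm : MeasurableSet Ω) {R : ℝ}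
    (hR : 0 < R) (hΩ : Ω ⊆ Metric.ball 0 R) {p α γ ε : ℝ} (hp : 2 ≤ p) (hα : 0 < α) (hε : 0 < ε)
    {ξ₁ ξ₂ : Eucl N → ℝ} (hξ₂ : MemLp ξ₂ ⊤ (volume.restrict Ω))
    (hξ : ∀ᵐ x ∂(volume.restrict Ω), α ≤ ξ₁ x)
    {f : Eucl N → ℝ} (hf : MemLp f 2 (volume.restrict Ω)) (hk : 1 ≤ k) (hF : IsTruncation k F)
    {A : Eucl N → Matrix (Fin N) (Fin N) ℝ} (hA : IsAdmissibleControl Ω ξ₁ ξ₂ γ A) {y : H01 Ω}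
    (hy : IsRegularizedSolution Ω p f ε F A y) :
    ∃ t : Eucl N → ℝ, (∀ x, 0 ≤ t x) ∧
      (∀ᵐ x ∂(volume.restrict Ω), α ^ 2 * ‖H01.grad y x‖ ^ 2 ≤ t x) ∧
      Integrable t (volume.restrict Ω) ∧
      Integrable (fun x => min (t x) ((k : ℝ) ^ 2) ^ (p / 2)) (volume.restrict Ω) ∧
      ∫ x in Ω, t x ≤ 2 * volume.real Ω + (2 * R) ^ 2 / α ^ 2 * ∫ x in Ω, f x ^ 2 ∧
      ∫ x in Ω, min (t x) ((k : ℝ) ^ 2) ^ (p / 2)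
        ≤ 2 * volume.real Ω + (2 * R) ^ 2 / α ^ 2 * ∫ x in Ω, f x ^ 2 := by
  set μ := volume.restrict Ω with hμ
  have hΩf : volume Ω ≠ ⊤ := ((measure_mono hΩ).trans_lt measure_ball_lt_top).ne
  have hfin : IsFiniteMeasure μ := ⟨by simpa [hμ] using hΩf.lt_top⟩
  have hgm : StronglyMeasurable (H01.grad y) := Lp.stronglyMeasurable y.1.2
  have hym : StronglyMeasurable (H01.fn y) := Lp.stronglyMeasurable y.1.1
  have hgL : MemLp (H01.grad y) 2 μ := Lp.memLp y.1.2
  have hyL : MemLp (H01.fn y) 2 μ := Lp.memLp y.1.1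
  set t : Eucl N → ℝ := fun x => ‖(CFC.sqrt (A x)).toEuclideanLin (H01.grad y x)‖ ^ 2 with ht
  have ht0 : ∀ x, 0 ≤ t x := fun x => sq_nonneg _
  have htA : ∀ᵐ x ∂μ, t x = inner ℝ ((A x).toEuclideanLin (H01.grad y x)) (H01.grad y x) := by
    filter_upwards [hA.isSymm, hA.bounds] with x h1 h2
    exact norm_sq_toEuclideanLin_sqrt h1
      (fun η => (mul_nonneg (sq_nonneg _) (sq_nonneg _)).trans (h2 η).1) _
  have htm : AEStronglyMeasurable t μ :=
    (aestronglyMeasurable_toEuclideanLin (fun i j => (hA.memBV_sqrt.2.1 i j).1)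
      hgL.1).norm.pow 2
  have hlow : ∀ᵐ x ∂μ, α ^ 2 * ‖H01.grad y x‖ ^ 2 ≤ t x := by
    filter_upwards [htA, hA.bounds, hξ] with x h1 h2 h3
    rw [h1, real_inner_comm]
    refine le_trans ?_ (h2 _).1
    gcongr
  have hgi : Integrable (fun x => ‖H01.grad y x‖ ^ 2) μ := hgL.integrable_norm_pow two_ne_zero
  have hti : Integrable t μ := by
    obtain ⟨c, hc⟩ : ∃ c : ℝ, ∀ᵐ x ∂μ, ‖ξ₂ x‖ ≤ c :=
      ⟨(eLpNorm ξ₂ ⊤ μ).toReal, by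
        have h1 := ae_le_eLpNormEssSup (f := ξ₂) (μ := μ)
        rw [← eLpNorm_exponent_top] at h1
        filter_upwards [h1] with x hx
        have := ENNReal.toReal_mono hξ₂.2.ne hx
        simpa using this⟩
    refine (hgi.const_mul (c ^ 2)).mono' htm ?_
    filter_upwards [htA, hA.bounds, hc] with x h1 h2 h3
    rw [Real.norm_of_nonneg (ht0 x), h1, real_inner_comm]
    refine (h2 _).2.trans ?_
    rw [← sq_abs (ξ₂ x), ← Real.norm_eq_abs]
    gcongr
  set a : Eucl N → ℝ := fun x => (ε + F (t x)) ^ ((p - 2) / 2) * t x with ha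
  have hcoef : ∀ x, 0 ≤ (ε + F (t x)) ^ ((p - 2) / 2) := fun x =>
    Real.rpow_nonneg (add_nonneg hε.le (hF.mapsTo (ht0 x))) _
  have hFm : AEMeasurable (fun x => F (t x)) μ := hF.measurable_comp htm.aemeasurable ht0
  have ham : AEStronglyMeasurable a μ :=
    (((hFm.const_add ε).pow_const _).mul htm.aemeasurable).aestronglyMeasurable
  have hai : Integrable a μ := by
    refine (hti.const_mul ((ε + ((k : ℝ) ^ 2 + 1)) ^ ((p - 2) / 2))).mono' ham
      (Eventually.of_forall fun x => ?_)
    rw [Real.norm_of_nonneg (mul_nonneg (hcoef x) (ht0 x))]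
    refine mul_le_mul_of_nonneg_right ?_ (ht0 x)
    exact Real.rpow_le_rpow (add_nonneg hε.le (hF.mapsTo (ht0 x)))
      (by linarith [hF.le_const (ht0 x)]) (by linarith)
  have hmini : Integrable (fun x => min (t x) ((k : ℝ) ^ 2) ^ (p / 2)) μ := by
    refine hai.mono' ((htm.aemeasurable.min aemeasurable_const).pow_const _).aestronglyMeasurable
      (Eventually.of_forall fun x => ?_)
    rw [Real.norm_of_nonneg (Real.rpow_nonneg (le_min (ht0 x) (sq_nonneg _)) _)]
    exact hF.min_rpow_le hp hε (ht0 x)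
  -- the weak formulation tested with the solution itself
  have hen : ∫ x, a x ∂μ = ∫ x, f x * H01.fn y x ∂μ := by
    rw [← hy y]
    refine integral_congr_ae ?_
    filter_upwards [htA] with x hx
    simp only [ha]
    rw [← hx]
  have hfi : Integrable (fun x => f x ^ 2) μ := hf.integrable_sq
  have hyi : Integrable (fun x => H01.fn y x ^ 2) μ := hyL.integrable_sq
  have hpoinc : ∫ x, H01.fn y x ^ 2 ∂μ ≤ (2 * R) ^ 2 * ∫ x, ‖H01.grad y x‖ ^ 2 ∂μ := by
    have h1 := integral_norm_sq_eq_norm_sq y.1.1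
    have h2 := integral_norm_sq_eq_norm_sq y.1.2
    have h3 := H01.norm_le_norm_grad hN hΩm hR.le hΩ y
    have e1 : ∫ x, H01.fn y x ^ 2 ∂μ = ‖y.1.1‖ ^ 2 := by
      rw [← h1]; simp [H01.fn, hμ]
    have e2 : ∫ x, ‖H01.grad y x‖ ^ 2 ∂μ = ‖y.1.2‖ ^ 2 := h2
    rw [e1, e2, ← mul_pow]
    exact pow_le_pow_left₀ (norm_nonneg _) h3 2
  have hgt : α ^ 2 * ∫ x, ‖H01.grad y x‖ ^ 2 ∂μ ≤ ∫ x, t x ∂μ := by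
    rw [← integral_const_mul]
    exact integral_mono_ae (hgi.const_mul _) hti hlow
  set β : ℝ := (2 * R) ^ 2 / α ^ 2 with hβ
  have hβ0 : 0 < β := by positivity
  -- Young's inequality with the weight that lets half of the Dirichlet energy be absorbed
  have hyoung : ∫ x, f x * H01.fn y x ∂μ
      ≤ β / 2 * (∫ x, f x ^ 2 ∂μ) + 1 / (2 * β) * ∫ x, H01.fn y x ^ 2 ∂μ := by
    rw [← integral_const_mul, ← integral_const_mul,
      ← integral_add (hfi.const_mul _) (hyi.const_mul _)]
    refine integral_mono (hf.integrable_mul hyL) ((hfi.const_mul _).add (hyi.const_mul _))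
      fun x => ?_
    have e : β / 2 * f x ^ 2 + 1 / (2 * β) * H01.fn y x ^ 2 - f x * H01.fn y x
        = (β * f x - H01.fn y x) ^ 2 / (2 * β) := by field_simp; ring
    have : 0 ≤ (β * f x - H01.fn y x) ^ 2 / (2 * β) := by positivity
    linarith
  have habs : 1 / (2 * β) * ∫ x, H01.fn y x ^ 2 ∂μ ≤ 1 / 2 * ∫ x, t x ∂μ := by
    calc 1 / (2 * β) * ∫ x, H01.fn y x ^ 2 ∂μ
        ≤ 1 / (2 * β) * ((2 * R) ^ 2 * ∫ x, ‖H01.grad y x‖ ^ 2 ∂μ) := by gcongr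
      _ = 1 / 2 * (α ^ 2 * ∫ x, ‖H01.grad y x‖ ^ 2 ∂μ) := by rw [hβ]; field_simp
      _ ≤ _ := by gcongr
  have hta : ∫ x, t x ∂μ ≤ volume.real Ω + ∫ x, a x ∂μ := by
    have h1 : ∫ x, (t x - 1) ∂μ ≤ ∫ x, a x ∂μ :=
      integral_mono (hti.sub (integrable_const 1)) hai fun x => hF.sub_one_le hk hp hε (ht0 x)
    rw [integral_sub hti (integrable_const 1)] at h1
    have h2 : ∫ _, (1 : ℝ) ∂μ = volume.real Ω := by simp [hμ]
    linarith
  have hma : ∫ x, min (t x) ((k : ℝ) ^ 2) ^ (p / 2) ∂μ ≤ ∫ x, a x ∂μ :=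
    integral_mono hmini hai fun x => hF.min_rpow_le hp hε (ht0 x)
  have hv0 : 0 ≤ volume.real Ω := measureReal_nonneg
  have hf0 : 0 ≤ ∫ x, f x ^ 2 ∂μ := integral_nonneg fun x => sq_nonneg _
  refine ⟨t, ht0, hlow, hti, hmini, ?_, ?_⟩ <;> linarith

/-! ### Passage to the weak limit -/

/-- The functional `v ↦ ∫_Ω (φ, ∇v)` on `H₀¹(Ω)`. -/
noncomputable def H01.gradPairing (φ : Lp (Eucl N) 2 (volume.restrict Ω)) : H01 Ω →L[ℝ] ℝ :=
  (innerSL ℝ φ).comp ((ContinuousLinearMap.snd ℝ _ _).comp (H01 Ω).subtypeL)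

theorem H01.gradPairing_apply (φ : Lp (Eucl N) 2 (volume.restrict Ω)) (v : H01 Ω) :
    H01.gradPairing φ v = ∫ x in Ω, inner ℝ (φ x) (H01.grad v x) := by
  change inner ℝ φ v.1.2 = _
  rw [L2.inner_def]
  rfl

theorem continuous_weakSpace_apply {E : Type*} [NormedAddCommGroup E] [NormedSpace ℝ E]
    (ℓ : E →L[ℝ] ℝ) : Continuous fun x : WeakSpace ℝ E => ℓ ((toWeakSpace ℝ E).symm x) :=
  WeakBilin.eval_continuous (topDualPairing ℝ E).flip ℓ

theorem mapClusterPt_integral_inner_grad {ι : Type*} {l : Filter ι} {y : ι → H01 Ω} {y₀ : H01 Ω}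
    (hy₀ : MapClusterPt (toWeakSpace ℝ (H01 Ω) y₀) l fun i => toWeakSpace ℝ (H01 Ω) (y i))
    {φ : Eucl N → Eucl N} (hφ : MemLp φ 2 (volume.restrict Ω)) :
    MapClusterPt (∫ x in Ω, inner ℝ (φ x) (H01.grad y₀ x)) l
      fun i => ∫ x in Ω, inner ℝ (φ x) (H01.grad (y i) x) := by
  have happ : ∀ v : H01 Ω, H01.gradPairing (hφ.toLp φ) v = ∫ x in Ω, inner ℝ (φ x) (H01.grad v x) :=
    fun v => by
      refine (H01.gradPairing_apply _ _).trans (integral_congr_ae ?_)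
      filter_upwards [hφ.coeFn_toLp] with x hx
      exact congrArg (fun w => inner ℝ w (H01.grad v x)) hx
  have h1 := hy₀.continuousAt_comp
    (continuous_weakSpace_apply (H01.gradPairing (hφ.toLp φ))).continuousAt
  have h2 : (fun i => ∫ x in Ω, inner ℝ (φ x) (H01.grad (y i) x))
      = fun i => H01.gradPairing (hφ.toLp φ) (y i) := funext fun i => (happ _).symm
  rw [← happ, h2]
  exact h1

/-- Young's inequality where `t ≤ T²`; where `t > T²` the gradient `G` is paid for by `t / T`, which
becomes negligible as `T → ∞`. -/
theorem mul_le_truncated_young {p α M T b G t : ℝ} (hp : 1 < p) (hα : 0 < α) (hb : 0 ≤ b)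
    (hbM : b ≤ M) (hG : 0 ≤ G) (ht : 0 ≤ t) (hGt : α ^ 2 * G ^ 2 ≤ t) (hT : 0 < T) :
    b * G ≤ α⁻¹ ^ p / p * min t (T ^ 2) ^ (p / 2) + b ^ p.conjExponent / p.conjExponent
      + M * α⁻¹ * t / T := by
  have hc := Real.HolderConjugate.conjExponent hp
  have hq := hc.symm.pos
  have hGs : G ≤ α⁻¹ * √t := by
    have h1 : α * G ≤ √t := Real.le_sqrt_of_sq_le (by rw [mul_pow]; exact hGt)
    rw [← div_eq_inv_mul, le_div_iff₀ hα]; linarith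
  have hα' : 0 < α⁻¹ := inv_pos.2 hα
  have hM : 0 ≤ M := hb.trans hbM
  have hm : 0 ≤ min t (T ^ 2) := le_min ht (sq_nonneg T)
  have h1 : 0 ≤ α⁻¹ ^ p / p * min t (T ^ 2) ^ (p / 2) := by positivity
  have h2 : 0 ≤ b ^ p.conjExponent / p.conjExponent := by positivity
  have h3 : 0 ≤ M * α⁻¹ * t / T := by positivity
  rcases le_total t (T ^ 2) with h | h
  · have hy := Real.young_inequality_of_nonneg hG hb hc
    have h4 : G ^ p ≤ α⁻¹ ^ p * min t (T ^ 2) ^ (p / 2) := by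
      rw [min_eq_left h]
      refine (Real.rpow_le_rpow hG hGs (by linarith)).trans (le_of_eq ?_)
      rw [Real.mul_rpow hα'.le (Real.sqrt_nonneg _), Real.sqrt_eq_rpow, ← Real.rpow_mul ht]
      congr 2; ring
    have h5 : G ^ p / p ≤ α⁻¹ ^ p / p * min t (T ^ 2) ^ (p / 2) := by
      rw [div_mul_eq_mul_div]; gcongr
    rw [mul_comm b G]; linarith
  · have h4 : T ≤ √t := Real.le_sqrt_of_sq_le h
    have h5 : √t ≤ t / T := by
      rw [le_div_iff₀ hT]
      calc √t * T ≤ √t * √t := by gcongr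
        _ = t := Real.mul_self_sqrt ht
    have h6 : b * G ≤ M * α⁻¹ * t / T := by
      calc b * G ≤ M * (α⁻¹ * (t / T)) := by
            refine mul_le_mul hbM (hGs.trans ?_) hG hM
            gcongr
        _ = _ := by ring
    linarith

/-- The truncated energy bounds survive in the weak limit. Testing against
`φ = 1_{|g₀| ≤ M} |g₀|^{p-2} g₀` gives `X = ∫_{|g₀| ≤ M} |g₀|^p ≤ C' / p + X / p'`, where `p'` is
the conjugate exponent and `C' = α^{-p} C`. As `X` is finite, `X ≤ C'`, uniformly in `M`. -/
theorem setLIntegral_enorm_rpow_le_of_mapClusterPt {μ : Measure (Eucl N)} [IsFiniteMeasure μ]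
    {ι : Type*} {l : Filter ι} {κ : ι → ℕ} (hκ : Tendsto κ l atTop) {g : ι → Eucl N → Eucl N}
    {g₀ : Eucl N → Eucl N} (hg : ∀ i, MemLp (g i) 2 μ) (hg₀m : StronglyMeasurable g₀)
    (hcl : ∀ φ : Eucl N → Eucl N, MemLp φ 2 μ →
      MapClusterPt (∫ x, inner ℝ (φ x) (g₀ x) ∂μ) l fun i => ∫ x, inner ℝ (φ x) (g i x) ∂μ)
    {p α C : ℝ} (hp : 2 ≤ p) (hα : 0 < α)
    (hbound : ∀ i, 1 ≤ κ i → ∃ t : Eucl N → ℝ, (∀ x, 0 ≤ t x) ∧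
      (∀ᵐ x ∂μ, α ^ 2 * ‖g i x‖ ^ 2 ≤ t x) ∧ Integrable t μ ∧
      Integrable (fun x => min (t x) ((κ i : ℝ) ^ 2) ^ (p / 2)) μ ∧
      ∫ x, t x ∂μ ≤ C ∧ ∫ x, min (t x) ((κ i : ℝ) ^ 2) ^ (p / 2) ∂μ ≤ C) (M : ℕ) :
    ∫⁻ x in {x | ‖g₀ x‖ ≤ M}, ‖g₀ x‖ₑ ^ p ∂μ ≤ ENNReal.ofReal (α⁻¹ ^ p * C) := by
  have hp1 : 1 < p := by linarith
  set s : Set (Eucl N) := {x | ‖g₀ x‖ ≤ M} with hs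
  have hsm : MeasurableSet s := hg₀m.norm.measurable measurableSet_Iic
  -- the test field `1_{|g₀| ≤ M} |g₀|^{p-2} g₀`
  set φ : Eucl N → Eucl N := s.indicator fun x => ‖g₀ x‖ ^ (p - 2) • g₀ x with hφ
  have hφm : StronglyMeasurable φ :=
    ((hg₀m.norm.measurable.pow_const _).stronglyMeasurable.smul hg₀m).indicator hsm
  have hφn : ∀ x, ‖φ x‖ = s.indicator (fun x => ‖g₀ x‖ ^ (p - 1)) x := fun x => by
    by_cases hx : x ∈ s
    · simp only [hφ, indicator_of_mem hx]
      rw [norm_smul, Real.norm_of_nonneg (Real.rpow_nonneg (norm_nonneg _) _),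
        ← Real.rpow_add_one' (norm_nonneg _) (by linarith)]
      congr 1; ring
    · simp [hφ, indicator_of_notMem hx]
  have hφM : ∀ x, ‖φ x‖ ≤ (M : ℝ) ^ (p - 1) := fun x => by
    rw [hφn]
    by_cases hx : x ∈ s
    · simp only [indicator_of_mem hx]
      exact Real.rpow_le_rpow (norm_nonneg _) hx (by linarith)
    · simp only [indicator_of_notMem hx]; positivity
  have hφL : MemLp φ 2 μ := MemLp.of_bound hφm.aestronglyMeasurable _ (Eventually.of_forall hφM)
  set E : Eucl N → ℝ := s.indicator fun x => ‖g₀ x‖ ^ p with hE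
  have hE0 : ∀ x, 0 ≤ E x := fun x => indicator_nonneg (fun _ _ => by positivity) x
  have hEm : Measurable E := (hg₀m.norm.measurable.pow_const _).indicator hsm
  have hEi : Integrable E μ := by
    refine Integrable.of_bound hEm.aestronglyMeasurable ((M : ℝ) ^ p) (Eventually.of_forall ?_)
    intro x
    rw [Real.norm_of_nonneg (hE0 x)]
    by_cases hx : x ∈ s
    · simp only [hE, indicator_of_mem hx]
      exact Real.rpow_le_rpow (norm_nonneg _) hx (by linarith)
    · simp only [hE, indicator_of_notMem hx]; positivity
  have hEinner : ∀ x, inner ℝ (φ x) (g₀ x) = E x := fun x => by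
    by_cases hx : x ∈ s
    · simp only [hφ, hE, indicator_of_mem hx]
      rw [real_inner_smul_left, real_inner_self_eq_norm_sq, ← Real.rpow_natCast,
        ← Real.rpow_add' (norm_nonneg _) (by push_cast; linarith)]
      congr 1; push_cast; ring
    · simp [hφ, hE, indicator_of_notMem hx]
  have hEconj : ∀ x, ‖φ x‖ ^ p.conjExponent = E x := fun x => by
    rw [hφn]
    by_cases hx : x ∈ s
    · simp only [hE, indicator_of_mem hx]
      rw [← Real.rpow_mul (norm_nonneg _), Real.conjExponent, mul_div_cancel₀]
      linarith
    · simp only [hE, indicator_of_notMem hx]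
      exact Real.zero_rpow (Real.HolderConjugate.conjExponent hp1).symm.ne_zero
  set X := ∫ x, E x ∂μ with hX
  have hclX : MapClusterPt X l fun i => ∫ x, inner ℝ (φ x) (g i x) ∂μ := by
    have h1 := hcl φ hφL
    simp only [hEinner] at h1
    exact h1
  have hup : ∀ i, 1 ≤ κ i → ∫ x, inner ℝ (φ x) (g i x) ∂μ ≤ α⁻¹ ^ p / p * C + X / p.conjExponent
      + (M : ℝ) ^ (p - 1) * α⁻¹ * C / κ i := fun i hi => by
    obtain ⟨t, ht0, hgt, hti, hmi, htC, hmC⟩ := hbound i hi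
    have hκ0 : (0 : ℝ) < κ i := by exact_mod_cast hi
    have hint : Integrable (fun x => inner ℝ (φ x) (g i x)) μ :=
      (((hg i).integrable one_le_two).norm.const_mul ((M : ℝ) ^ (p - 1))).mono'
        (hφm.aestronglyMeasurable.inner (hg i).1) (Eventually.of_forall fun x =>
          (norm_inner_le_norm _ _).trans (mul_le_mul_of_nonneg_right (hφM x) (norm_nonneg _)))
    have j1 := hmi.const_mul (α⁻¹ ^ p / p)
    have j2 := hEi.div_const p.conjExponent
    have j3 := (hti.const_mul ((M : ℝ) ^ (p - 1) * α⁻¹)).div_const (κ i : ℝ)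
    calc ∫ x, inner ℝ (φ x) (g i x) ∂μ
        ≤ ∫ x, (α⁻¹ ^ p / p * min (t x) ((κ i : ℝ) ^ 2) ^ (p / 2) + E x / p.conjExponent
            + (M : ℝ) ^ (p - 1) * α⁻¹ * t x / κ i) ∂μ := by
          refine integral_mono_ae hint ((j1.add j2).add j3) ?_
          filter_upwards [hgt] with x hx
          refine (real_inner_le_norm _ _).trans ?_
          rw [← hEconj]
          exact mul_le_truncated_young hp1 hα (norm_nonneg _) (hφM x) (norm_nonneg _) (ht0 x) hx hκ0
      _ = α⁻¹ ^ p / p * (∫ x, min (t x) ((κ i : ℝ) ^ 2) ^ (p / 2) ∂μ) + X / p.conjExponent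
            + (M : ℝ) ^ (p - 1) * α⁻¹ * (∫ x, t x ∂μ) / κ i := by
          rw [integral_add (by exact j1.add j2) j3, integral_add j1 j2, integral_const_mul,
            integral_div, integral_div, integral_const_mul]
      _ ≤ _ := by gcongr
  have hXle : X ≤ α⁻¹ ^ p / p * C + X / p.conjExponent := by
    have hlim : Tendsto (fun i => α⁻¹ ^ p / p * C + X / p.conjExponent
        + (M : ℝ) ^ (p - 1) * α⁻¹ * C / κ i) l
        (𝓝 (α⁻¹ ^ p / p * C + X / p.conjExponent)) := by
      have := (tendsto_const_nhds (x := (M : ℝ) ^ (p - 1) * α⁻¹ * C)).div_atTop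
        (tendsto_natCast_atTop_atTop.comp hκ)
      simpa using tendsto_const_nhds.add this
    refine le_of_forall_pos_le_add fun δ hδ => ?_
    have hfr := hclX.frequently (eventually_gt_nhds (show X - δ / 2 < X by linarith))
    have hev := (hlim.eventually (eventually_lt_nhds (lt_add_of_pos_right _ (half_pos hδ)))).and
      (hκ.eventually_ge_atTop 1)
    obtain ⟨i, h1, h2, h3⟩ := (hfr.and_eventually hev).exists
    have := hup i h3
    linarith
  have hXfin : X ≤ α⁻¹ ^ p * C := by
    have hc := (Real.HolderConjugate.conjExponent hp1).inv_add_inv_eq_one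
    have h1 : X / p.conjExponent = X - X / p := by
      rw [div_eq_mul_inv, div_eq_mul_inv, eq_sub_of_add_eq' hc]; ring
    rw [h1, div_mul_eq_mul_div] at hXle
    have h2 : X / p ≤ α⁻¹ ^ p * C / p := by linarith
    exact (div_le_div_iff_of_pos_right (by linarith)).1 h2
  calc ∫⁻ x in s, ‖g₀ x‖ₑ ^ p ∂μ = ∫⁻ x, ENNReal.ofReal (E x) ∂μ := by
        rw [← lintegral_indicator hsm]
        refine lintegral_congr fun x => ?_
        by_cases hx : x ∈ s
        · simp only [hE, indicator_of_mem hx]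
          rw [← ofReal_norm, ENNReal.ofReal_rpow_of_nonneg (norm_nonneg _) (by linarith)]
        · simp [hE, indicator_of_notMem hx]
    _ = ENNReal.ofReal X :=
        (ofReal_integral_eq_lintegral_ofReal hEi (Eventually.of_forall hE0)).symm
    _ ≤ _ := ENNReal.ofReal_le_ofReal hXfin

theorem memLp_of_setLIntegral_norm_le {μ : Measure (Eucl N)} {g : Eucl N → Eucl N}
    (hg : StronglyMeasurable g) {p : ℝ} (hp : 0 < p) {C : ℝ≥0∞} (hC : C ≠ ⊤)
    (h : ∀ M : ℕ, ∫⁻ x in {x | ‖g x‖ ≤ M}, ‖g x‖ₑ ^ p ∂μ ≤ C) :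
    MemLp g (ENNReal.ofReal p) μ := by
  refine ⟨hg.aestronglyMeasurable, ?_⟩
  rw [eLpNorm_lt_top_iff_lintegral_rpow_enorm_lt_top (by simpa using hp) ENNReal.ofReal_ne_top,
    ENNReal.toReal_ofReal hp.le]
  have hU : ⋃ M : ℕ, {x | ‖g x‖ ≤ M} = univ :=
    eq_univ_of_forall fun x => mem_iUnion.2 (exists_nat_ge ‖g x‖)
  rw [← setLIntegral_univ, ← hU, setLIntegral_iUnion_of_directed]
  · exact (iSup_le h).trans_lt hC.lt_top
  · refine Monotone.directed_le fun a b hab x hx => ?_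
    exact le_trans (show ‖g x‖ ≤ a from hx) (by exact_mod_cast hab)

end Energy

theorem mainTheorem6 (N : ℕ) (hN : 1 ≤ N) (Ω : Set (Eucl N)) (hΩ_open : IsOpen Ω)
    (hΩ_bdd : Bornology.IsBounded Ω) (hΩ_lip : HasLipschitzBoundary Ω)
    (p : ℝ) (hp : 2 ≤ p)
    (α γ : ℝ) (hα : 0 < α) (hγ : 0 < γ) (ξ₁ ξ₂ : Eucl N → ℝ)
    (hξ₁ : MemLp ξ₁ ⊤ (volume.restrict Ω)) (hξ₁_bv : MemBV Ω ξ₁)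
    (hξ₂ : MemLp ξ₂ ⊤ (volume.restrict Ω)) (hξ₂_bv : MemBV Ω ξ₂)
    (hξ : ∀ᵐ x ∂(volume.restrict Ω), α ≤ ξ₁ x ∧ ξ₁ x ≤ ξ₂ x)
    (f : Eucl N → ℝ) (hf : MemLp f 2 (volume.restrict Ω))
    (F : ℕ → ℝ → ℝ) (hF : ∀ k, 1 ≤ k → IsTruncation k (F k))
    (ε : ℕ → ℝ) (hε_pos : ∀ n, 0 < ε n) (hε_anti : StrictAnti ε)
    (hε_lim : Tendsto ε atTop (𝓝 0))
    (A : ℕ → ℕ → Eucl N → Matrix (Fin N) (Fin N) ℝ)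
    (hA : ∀ n k, 1 ≤ k → IsAdmissibleControl Ω ξ₁ ξ₂ γ (A n k))
    (y : ℕ → ℕ → H01 Ω)
    (hy : ∀ n k, 1 ≤ k → IsRegularizedSolution Ω p f (ε n) (F k) (A n k) (y n k))
    (y₀ : H01 Ω)
    (hy₀ : MapClusterPt (toWeakSpace ℝ (H01 Ω) y₀) (atTop ×ˢ atTop)
      (fun m : ℕ × ℕ => toWeakSpace ℝ (H01 Ω) (y m.1 m.2))) :
    MemW01p Ω (ENNReal.ofReal p) (H01.fn y₀) := by
  have hΩm := hΩ_open.measurableSet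
  have : IsFiniteMeasure (volume.restrict Ω) := ⟨by simpa using hΩ_bdd.measure_lt_top⟩
  obtain ⟨R, hR, hΩR⟩ : ∃ R : ℝ, 0 < R ∧ Ω ⊆ Metric.ball 0 R := by
    obtain ⟨r, hr⟩ := hΩ_bdd.subset_ball 0
    exact ⟨max r 1, by positivity, hr.trans (Metric.ball_subset_ball (le_max_left _ _))⟩
  have hgm : StronglyMeasurable (H01.grad y₀) := Lp.stronglyMeasurable y₀.1.2
  have hym : StronglyMeasurable (H01.fn y₀) := Lp.stronglyMeasurable y₀.1.1
  have hpair : IsW01pPair Ω 2 (H01.fn y₀) (H01.grad y₀) := y₀.2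
  have hp1 : 1 < ENNReal.ofReal p := by
    rw [← ENNReal.ofReal_one, ENNReal.ofReal_lt_ofReal_iff] <;> linarith
  have hg : MemLp (H01.grad y₀) (ENNReal.ofReal p) (volume.restrict Ω) :=
    memLp_of_setLIntegral_norm_le hgm (by linarith) ENNReal.ofReal_ne_top
      (setLIntegral_enorm_rpow_le_of_mapClusterPt (κ := Prod.snd) tendsto_snd
        (fun m => Lp.memLp (y m.1 m.2).1.2) hgm
        (fun φ hφ => mapClusterPt_integral_inner_grad hy₀ hφ) hp hα fun m hm =>
        (hy m.1 m.2 hm).exists_energy_bound hN hΩm hR hΩR hp hα (hε_pos _) hξ₂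
          (hξ.mono fun _ h => h.1) hf hm (hF _ hm) (hA _ _ hm))
  have hyL : MemLp (H01.fn y₀) (ENNReal.ofReal p) (volume.restrict Ω) :=
    ⟨hym.aestronglyMeasurable, (hpair.eLpNorm_le_eLpNorm_grad (by norm_num) (by norm_num) hgm hym
      hN hΩm hΩR hp1 ENNReal.ofReal_ne_top).trans_lt
        (ENNReal.mul_lt_top ENNReal.ofReal_lt_top hg.2)⟩
  exact ⟨_, hpair.isW01pPair_of_memLp (by norm_num) hp1 ENNReal.ofReal_ne_top hΩ_open hΩ_bdd hΩ_lip
    hym hgm hyL hg⟩
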